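/- Let $M$ be a smooth, finite-dimensional, Hausdorff, second countable manifold without boundary with a Poisson bivector field $\Pi\in\Gamma(\bigwedge^2TM)$, $[\Pi,\Pi]=0$, and bracket $\{f,g\}=\Pi(df,dg)$ on $C^\infty(M)$. Let $\iota:N\to M$ be an embedded submanifold and let $B\neq 0$ be a smooth vector subbundle (of constant rank) of $T_NM:=\iota^*(TM)$. Put $$\mathcal I=\{f\in C^\infty(M): f|_N=0\},\qquad \mathcal B=\{f\in C^\infty(M): Xf=0\ \ \forall X\in\Gamma(B)\},$$ and suppose that $\mathcal B$ is a Lie subalgebra, $\{\mathcal B,\mathcal B\}\subset\mathcal B$. Then: (a) $\mathcal B\subset\mathcal N:=\{g\in C^\infty(M):\{\mathcal I,g\}\subset\mathcal I\}$. (b) $\mathcal B\cap\mathcal I$ is a Poisson ideal of $\mathcal B$. (c) $\mathcal B/(\mathcal B\cap\mathcal I)$ inherits a Poisson bracket: there is exactly one Poisson bracket on this algebra with $\{f+\mathcal B\cap\mathcal I,\,g+\mathcal B\cap\mathcal I\}=\{f,g\}+\mathcal B\cap\mathcal I$ for all $f,g\in\mathcal B$. (d) There is exactly one Poisson bracket on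 $(\mathcal B+\mathcal I)/\mathcal I$ with $\{f+\mathcal I,g+\mathcal I\}=\{f,g\}+\mathcal I$ for all $f,g\in\mathcal B$, and the canonical map $\mathcal B/(\mathcal B\cap\mathcal I)\to(\mathcal B+\mathcal I)/\mathcal I$ is an isomorphism of algebras which carries the bracket of (c) to it. Let $B'\neq0$ be another smooth subbundle (of constant rank) of $T_NM$ such that the algebra $\mathcal B'$ defined by it is a Lie subalgebra. Then the brackets induced on $(\mathcal B+\mathcal I)/\mathcal I$ and on $(\mathcal B'+\mathcal I)/\mathcal I$ agree on the intersection of these two subalgebras of $C^\infty(M)/\mathcal I$; in particular they coincide whenever $\mathcal B+\mathcal I=\mathcal B'+\mathcal I$. Moreover, let $N$ be closed in $M$. - If $B\cap TN$ is a subbundle (of constant rank) and $B\cap TN=B'\cap TN$, then $\mathcal B+\mathcal I=\mathcal B'+\mathcal I$; hence the two induced Poisson brackets on $(\mathcal B+\mathcal I)/\mathcal I$ coincide. - Conversely, if $D=B\cap TN$ and $D'=B'\cap TN$ are subbundles (of constant rank), each of which is determined by its first integrals (a vector $v\in T_qN$ with $dh(v)=0$ for every $h\in C^\infty(N)$ whose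 differential vanishes on $D$ lies in $D$, and likewise for $D'$), then $\mathcal B+\mathcal I=\mathcal B'+\mathcal I$ implies $B\cap TN=B'\cap TN$. -/

import Mathlib

set_option maxSynthPendingDepth 3

open scoped Manifold ContDiff Bundle

/-! ## Poisson algebras -/

/-- A Poisson bracket on a commutative real algebra: a Lie bracket that is a derivation in each
argument (the Leibniz rule in the first argument follows by antisymmetry). -/
@[ext]
structure PoissonBracket (A : Type*) [CommRing A] [Algebra ℝ A] where
  bracket : A →ₗ[ℝ] A →ₗ[ℝ] A
  self_eq_zero : ∀ a, bracket a a = 0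
  jacobi : ∀ a b c,
    bracket a (bracket b c) + bracket b (bracket c a) + bracket c (bracket a b) = 0
  leibniz : ∀ a b c, bracket a (b * c) = bracket a b * c + b * bracket a c

namespace Reduction

noncomputable section

section Algebra

variable {A : Type*} [CommRing A] [Algebra ℝ A]

/-- The subalgebra `S` is closed under the bracket `br`. -/
def IsLieSubalgebra (br : A → A → A) (S : Subalgebra ℝ A) : Prop :=
  ∀ f ∈ S, ∀ g ∈ S, br f g ∈ S

/-- The Lie normaliser `{g | {𝓘, g} ⊆ 𝓘}` of an ideal `𝓘`. -/
def lieNormaliser (br : A → A → A) (I : Ideal A) : Set A :=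
  {g | ∀ f ∈ I, br f g ∈ I}

/-- `S ∩ I`, as an ideal of `S`. -/
def interIdeal (S : Subalgebra ℝ A) (I : Ideal A) : Ideal S := I.comap S.val

/-- The ideal `J` of the Lie subalgebra `S` is a Poisson ideal of `S`:
`{J, S} ⊆ J` (`S * J ⊆ J` being part of the notion of an ideal). -/
def IsPoissonIdeal {br : A → A → A} {S : Subalgebra ℝ A} (hS : IsLieSubalgebra br S)
    (J : Ideal S) : Prop :=
  ∀ j ∈ J, ∀ f : S, (⟨br j f, hS j j.2 f f.2⟩ : S) ∈ J

/-- The subalgebra `S + I` of `A`. -/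
def sumSubalgebra (S : Subalgebra ℝ A) (I : Ideal A) : Subalgebra ℝ A where
  carrier := {a | ∃ f ∈ S, ∃ i ∈ I, f + i = a}
  mul_mem' := by
    rintro _ _ ⟨f, hf, i, hi, rfl⟩ ⟨g, hg, j, hj, rfl⟩
    refine ⟨f * g, S.mul_mem hf hg, f * j + i * (g + j), ?_, by ring⟩
    exact I.add_mem (I.mul_mem_left _ hj) (I.mul_mem_right _ hi)
  add_mem' := by
    rintro _ _ ⟨f, hf, i, hi, rfl⟩ ⟨g, hg, j, hj, rfl⟩
    exact ⟨f + g, S.add_mem hf hg, i + j, I.add_mem hi hj, by ring⟩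
  algebraMap_mem' c := ⟨algebraMap ℝ A c, S.algebraMap_mem c, 0, I.zero_mem, add_zero _⟩

/-- `(S + I) / I`, as a subalgebra of `A / I`. -/
def sumQuotient (S : Subalgebra ℝ A) (I : Ideal A) : Subalgebra ℝ (A ⧸ I) :=
  (sumSubalgebra S I).map (Ideal.Quotient.mkₐ ℝ I)

lemma mk_mem_sumQuotient (S : Subalgebra ℝ A) (I : Ideal A) (f : S) :
    Ideal.Quotient.mk I (f : A) ∈ sumQuotient S I :=
  ⟨f, ⟨f, f.2, 0, I.zero_mem, add_zero _⟩, rfl⟩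

/-- The class in `(S + I) / I` of an element of `S`. -/
def toSumQuotient (S : Subalgebra ℝ A) (I : Ideal A) (f : S) : sumQuotient S I :=
  ⟨Ideal.Quotient.mk I (f : A), mk_mem_sumQuotient S I f⟩

/-- The Poisson bracket `P` on `S / (S ∩ I)` is inherited from `br`:
`{f + S ∩ I, g + S ∩ I} = {f, g} + S ∩ I` for `f, g ∈ S`. -/
def IsInherited {br : A → A → A} {S : Subalgebra ℝ A} (hS : IsLieSubalgebra br S) (I : Ideal A)
    (P : PoissonBracket (S ⧸ interIdeal S I)) : Prop :=
  ∀ f g : S, P.bracket (Ideal.Quotient.mk _ f) (Ideal.Quotient.mk _ g) =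
    Ideal.Quotient.mk _ (⟨br f g, hS f f.2 g g.2⟩ : S)

/-- The Poisson bracket `Q` on `(S + I) / I` is induced by `br`:
`{f + I, g + I} = {f, g} + I` for `f, g ∈ S`. -/
def IsInduced {br : A → A → A} {S : Subalgebra ℝ A} (hS : IsLieSubalgebra br S) (I : Ideal A)
    (Q : PoissonBracket (sumQuotient S I)) : Prop :=
  ∀ f g : S, Q.bracket (toSumQuotient S I f) (toSumQuotient S I g) =
    toSumQuotient S I (⟨br f g, hS f f.2 g g.2⟩ : S)

end Algebra

/-! ## Bivector fields and Poisson manifolds -/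

section Bivector

/-- The cotangent space at a point of a manifold modelled on `E`. -/
abbrev Cotangent (E : Type*) [NormedAddCommGroup E] [NormedSpace ℝ E] {M : Type*}
    [TopologicalSpace M] [ChartedSpace E M] (x : M) : Type _ :=
  TangentSpace 𝓘(ℝ, E) x →L[ℝ] ℝ

/-- A smooth bivector field on a (finite-dimensional) manifold `M` modelled on `E`: a smooth
section of the bundle whose fibre over `x` consists of the alternating bilinear forms on the
cotangent space at `x`, that is, of `⋀² T_x M`. -/
structure BivectorField (E : Type*) [NormedAddCommGroup E] [NormedSpace ℝ E] (M : Type*)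
    [TopologicalSpace M] [ChartedSpace E M] [IsManifold 𝓘(ℝ, E) ∞ M] where
  toFun : ∀ x : M, Cotangent E x →L[ℝ] Cotangent E x →L[ℝ] ℝ
  alt : ∀ (x : M) (ξ : Cotangent E x), toFun x ξ ξ = 0
  smooth : ContMDiff 𝓘(ℝ, E)
    (𝓘(ℝ, E).prod 𝓘(ℝ, (E →L[ℝ] ℝ) →L[ℝ] (E →L[ℝ] ℝ) →L[ℝ] ℝ)) ∞
    (fun x => Bundle.TotalSpace.mk' ((E →L[ℝ] ℝ) →L[ℝ] (E →L[ℝ] ℝ) →L[ℝ] ℝ)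
      (E := fun x : M => Cotangent E x →L[ℝ] Cotangent E x →L[ℝ] ℝ) x (toFun x))

variable {E : Type*} [NormedAddCommGroup E] [NormedSpace ℝ E]
  {M : Type*} [TopologicalSpace M] [ChartedSpace E M]

/-- The differential `d_x f` of a real function on `M`, as a cotangent vector. -/
def diff (f : M → ℝ) (x : M) : Cotangent E x := mfderiv 𝓘(ℝ, E) 𝓘(ℝ) f x

variable [IsManifold 𝓘(ℝ, E) ∞ M]

/-- The function `x ↦ Π_x(d_x f, d_x g)`. -/
def BivectorField.pairing (P : BivectorField E M) (f g : M → ℝ) (x : M) : ℝ :=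
  P.toFun x (diff f x) (diff g x)

lemma contMDiff_diff (f : C^∞⟮𝓘(ℝ, E), M; ℝ⟯) :
    ContMDiff 𝓘(ℝ, E) (𝓘(ℝ, E).prod 𝓘(ℝ, E →L[ℝ] ℝ)) ∞
      (fun x => Bundle.TotalSpace.mk' (E →L[ℝ] ℝ) (E := fun x : M => Cotangent E x) x
        (diff f x)) := by
  intro x
  rw [contMDiffAt_hom_bundle]
  refine ⟨contMDiffAt_id, ?_⟩
  have h := (f.contMDiff x).mfderiv_const (m := ∞) (by simp)
  convert h using 1
  funext y
  ext v
  simp [ContinuousLinearMap.inCoordinates, inTangentCoordinates]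
  rfl

lemma BivectorField.contMDiff_pairing (P : BivectorField E M) (f g : C^∞⟮𝓘(ℝ, E), M; ℝ⟯) :
    ContMDiff 𝓘(ℝ, E) 𝓘(ℝ) ∞ (P.pairing f g) := by
  have : ContMDiff 𝓘(ℝ, E) (𝓘(ℝ, E).prod 𝓘(ℝ)) ∞
      (fun m ↦ Bundle.TotalSpace.mk' ℝ (E := Bundle.Trivial M ℝ) m (P.pairing f g m)) := by
    intro x
    apply ContMDiffAt.clm_bundle_apply₂ (F₁ := E →L[ℝ] ℝ) (F₂ := E →L[ℝ] ℝ)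
      (E₁ := fun x : M => Cotangent E x) (E₂ := fun x : M => Cotangent E x)
    · exact P.smooth x
    · exact contMDiff_diff f x
    · exact contMDiff_diff g x
  intro x
  have h := this x
  rw [Bundle.contMDiffAt_totalSpace] at h
  exact h.2

/-- The bracket `{f, g} = Π(df, dg)` on `C^∞(M)`. -/
def BivectorField.bracket (P : BivectorField E M) (f g : C^∞⟮𝓘(ℝ, E), M; ℝ⟯) :
    C^∞⟮𝓘(ℝ, E), M; ℝ⟯ :=
  ⟨P.pairing f g, P.contMDiff_pairing f g⟩

/-- The linear coordinate function `α ∘ φ`, where `φ` is the chart of `M` at `x` (only its germ at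
`x` matters). Its differential at `x` is `α`, as `φ` identifies `T_x M` with `E`. -/
def coordFun (x : M) (α : E →L[ℝ] ℝ) : M → ℝ := fun y => α (extChartAt 𝓘(ℝ, E) x y)

/-- The Schouten-Nijenhuis bracket `[Π, Π]` (up to a nonzero constant depending on conventions) at
`x`, evaluated on three covectors, by its coordinate expression in the chart at `x`: with
`Π^{ij} = Π(dx^i, dx^j)`, its components are
`∑_l (Π^{il} ∂_l Π^{jk} + Π^{jl} ∂_l Π^{ki} + Π^{kl} ∂_l Π^{ij})`. -/
def BivectorField.schouten (P : BivectorField E M) (x : M) (α β γ : E →L[ℝ] ℝ) : ℝ :=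
  P.pairing (coordFun x α) (P.pairing (coordFun x β) (coordFun x γ)) x
    + P.pairing (coordFun x β) (P.pairing (coordFun x γ) (coordFun x α)) x
    + P.pairing (coordFun x γ) (P.pairing (coordFun x α) (coordFun x β)) x

/-- `Π` is a Poisson bivector field: `[Π, Π] = 0`. -/
def BivectorField.IsPoisson (P : BivectorField E M) : Prop :=
  ∀ (x : M) (α β γ : E →L[ℝ] ℝ), P.schouten x α β γ = 0

end Bivector

/-! ## Submanifolds and subbundles of `T_N M` -/

section Submanifold

variable {E : Type*} [NormedAddCommGroup E] [NormedSpace ℝ E]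
  {M : Type*} [TopologicalSpace M] [ChartedSpace E M] [IsManifold 𝓘(ℝ, E) ∞ M]
  (E' : Type*) [NormedAddCommGroup E'] [NormedSpace ℝ E']
  {N : Type*} [TopologicalSpace N] [ChartedSpace E' N]

/-- The ideal of smooth functions on `M` that vanish on the submanifold `ι : N → M`. -/
def vanishingIdeal (ι : N → M) : Ideal C^∞⟮𝓘(ℝ, E), M; ℝ⟯ where
  carrier := {f | ∀ q, f (ι q) = 0}
  add_mem' {f g} hf hg q := by simp [hf q, hg q]
  zero_mem' q := rfl
  smul_mem' c f hf q := by simp [hf q]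

/-- Smoothness on `U ⊆ N` of a section of `T_N M = ι^* TM`. -/
def IsSmoothSectionOn (ι : N → M) (X : ∀ q : N, TangentSpace 𝓘(ℝ, E) (ι q)) (U : Set N) : Prop :=
  ContMDiffOn 𝓘(ℝ, E') 𝓘(ℝ, E).tangent ∞
    (fun q => (⟨ι q, X q⟩ : TangentBundle 𝓘(ℝ, E) M)) U

/-- `B` is a smooth vector subbundle of rank `r` of `T_N M`: it has local smooth frames. -/
def IsSubbundle (ι : N → M) (r : ℕ) (B : ∀ q : N, Submodule ℝ (TangentSpace 𝓘(ℝ, E) (ι q))) :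
    Prop :=
  ∀ p : N, ∃ U : Set N, IsOpen U ∧ p ∈ U ∧
    ∃ s : Fin r → ∀ q : N, TangentSpace 𝓘(ℝ, E) (ι q),
      (∀ i, IsSmoothSectionOn E' ι (s i) U) ∧
      ∀ q ∈ U, LinearIndependent ℝ (fun i => s i q) ∧
        Submodule.span ℝ (Set.range fun i => s i q) = B q

/-- The global smooth sections `Γ(B)`. -/
def smoothSections (ι : N → M) (B : ∀ q : N, Submodule ℝ (TangentSpace 𝓘(ℝ, E) (ι q))) :
    Set (∀ q : N, TangentSpace 𝓘(ℝ, E) (ι q)) :=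
  {X | IsSmoothSectionOn E' ι X Set.univ ∧ ∀ q, X q ∈ B q}

/-- The algebra `{f ∈ C^∞(M) | X f = 0 for all X ∈ Γ(B)}`. -/
def annihilated (ι : N → M) (B : ∀ q : N, Submodule ℝ (TangentSpace 𝓘(ℝ, E) (ι q))) :
    Subalgebra ℝ C^∞⟮𝓘(ℝ, E), M; ℝ⟯ where
  carrier := {f | ∀ X ∈ smoothSections E' ι B, ∀ q, diff f (ι q) (X q) = 0}
  mul_mem' {f g} hf hg X hX q := by
    have h1 := (f.contMDiff.mdifferentiable (by simp) (ι q)).hasMFDerivAt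
    have h2 := (g.contMDiff.mdifferentiable (by simp) (ι q)).hasMFDerivAt
    have h3 : diff (E := E) (⇑(f * g)) (ι q) = _ := (h1.mul h2).mfderiv
    have h4 := hf X hX q
    have h5 := hg X hX q
    rw [h3]
    change f (ι q) * diff g (ι q) (X q) + g (ι q) * diff f (ι q) (X q) = 0
    rw [h4, h5, mul_zero, mul_zero, add_zero]
  add_mem' {f g} hf hg X hX q := by
    have h1 := (f.contMDiff.mdifferentiable (by simp) (ι q)).hasMFDerivAt
    have h2 := (g.contMDiff.mdifferentiable (by simp) (ι q)).hasMFDerivAt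
    have h3 : diff (E := E) (⇑(f + g)) (ι q) = _ := (h1.add h2).mfderiv
    rw [h3]
    have h4 := hf X hX q
    have h5 := hg X hX q
    change diff f (ι q) (X q) + diff g (ι q) (X q) = 0
    rw [h4, h5, add_zero]
  algebraMap_mem' c X hX q := by
    have h3 : diff (E := E) (fun _ : M => c) (ι q) = 0 := mfderiv_const
    change diff (E := E) (fun _ : M => c) (ι q) (X q) = 0
    rw [h3]
    rfl

/-- `B ∩ TN`, where `T_q N` is regarded as a subspace of `T_{ι q} M` through `dι`. -/
def interTangent (ι : N → M) (B : ∀ q : N, Submodule ℝ (TangentSpace 𝓘(ℝ, E) (ι q))) (q : N) :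
    Submodule ℝ (TangentSpace 𝓘(ℝ, E) (ι q)) :=
  B q ⊓ LinearMap.range (mfderiv 𝓘(ℝ, E') 𝓘(ℝ, E) ι q).toLinearMap

/-- A vector tangent to `N` that is annihilated by the differentials of all smooth functions on
`N` that are constant along the distribution `D` on `N` belongs to `D`. -/
def DeterminedByFirstIntegrals (ι : N → M)
    (D : ∀ q : N, Submodule ℝ (TangentSpace 𝓘(ℝ, E) (ι q))) : Prop :=
  ∀ (q : N) (v : TangentSpace 𝓘(ℝ, E') q),
    (∀ h : C^∞⟮𝓘(ℝ, E'), N; ℝ⟯,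
      (∀ (p : N) (w : TangentSpace 𝓘(ℝ, E') p),
        mfderiv 𝓘(ℝ, E') 𝓘(ℝ, E) ι p w ∈ D p → diff (E := E') h p w = 0) →
      diff (E := E') h q v = 0) →
    mfderiv 𝓘(ℝ, E') 𝓘(ℝ, E) ι q v ∈ D q

end Submanifold

end

end Reduction

/-! ## Poisson brackets on quotients -/

namespace PoissonBracket

variable {A : Type*} [CommRing A] [Algebra ℝ A]

/-! The heart is (a). For `f₁, f₂ ∈ 𝓘` the product `f₁ f₂` has zero differential along `N`, so it
lies in `𝓑`. For `g ∈ 𝓑`, differentiating `{f₁ f₂, g} ∈ 𝓑` along `v ∈ B` gives `df₁(v) {f₂, g} +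
df₂(v) {f₁, g} = 0` on `N`. Where some `k ∈ 𝓘` has `dk(v) ≠ 0`, this forces first `{k, g} = 0` and
then `{f, g} = 0` for every `f ∈ 𝓘`; continuity extends this to the closure `W̄` of the set of such
points. Near a point outside `W̄`, cut-offs `χ f` of elements of `𝓘` belong to `𝓑`, and so do the
products `h χ f` for arbitrary `h`. Differentiating `{h χ f, g}` along a nonzero `v ∈ B` with `dh(v)
≠ 0` again yields `{f, g} = 0`. This is `annihilated_subset_lieNormaliser`.

Given (a), parts (b) to (d) and the agreement of brackets are pure algebra: changing representatives
by `𝓘` changes a bracket by an element of `𝓘` (`existsUnique_push`, `IsInduced.bracket_eq`). The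
Jacobi identity on `C^∞(M)` follows from `[Π, Π] = 0` because second derivatives cancel in the
Jacobiator (`jacobiator_vbracket_eq`), which may therefore be computed on coordinate functions.

The comparison of `B ∩ TN` with `B' ∩ TN` rests on `exists_mem_annihilated_extension`: for closed
`N`, a function on `N` constant along `B ∩ TN` extends to an element of `𝓑`. Locally one extends by
a retraction and corrects the transverse derivatives by a term linear in functions vanishing on `N`;
constant rank of `B ∩ TN` makes the coefficients smooth. A partition of unity glues, since all local
extensions agree on `N`. -/

lemma antisymm (P : PoissonBracket A) (a b : A) : P.bracket a b = -P.bracket b a := by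
  have h := P.self_eq_zero (a + b)
  simp only [map_add, LinearMap.add_apply, P.self_eq_zero, zero_add, add_zero] at h
  exact eq_neg_of_add_eq_zero_right h

/-- A Poisson bracket descends along a surjection whose kernel is stable under it. -/
theorem existsUnique_push {C : Type*} [CommRing C] [Algebra ℝ C] (P : PoissonBracket A)
    (p : A →ₐ[ℝ] C) (hp : Function.Surjective p)
    (hker : ∀ f g, p f = 0 → p (P.bracket f g) = 0) :
    ∃! R : PoissonBracket C, ∀ f g, R.bracket (p f) (p g) = p (P.bracket f g) := by
  have hl : ∀ f f' g, p f = p f' → p (P.bracket f g) = p (P.bracket f' g) := by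
    intro f f' g h
    have := hker (f - f') g (by rw [map_sub, h, sub_self])
    rwa [map_sub, LinearMap.sub_apply, map_sub, sub_eq_zero] at this
  have hlr : ∀ f f' g g', p f = p f' → p g = p g' →
      p (P.bracket f g) = p (P.bracket f' g') := by
    intro f f' g g' h h'
    rw [hl f f' g h, P.antisymm, P.antisymm f', map_neg, map_neg, hl g g' f' h']
  -- An arbitrary set-theoretic section suffices: independence of representatives lets `σ (x + x')`
  -- be replaced by `σ x + σ x'`, which gives bilinearity.
  obtain ⟨σ, hσ⟩ := hp.hasRightInverse
  let b : C →ₗ[ℝ] C →ₗ[ℝ] C := LinearMap.mk₂ ℝ (fun x y => p (P.bracket (σ x) (σ y)))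
    (fun x x' y => by
      rw [hl _ (σ x + σ x') (σ y) (by simp [hσ _])]; simp)
    (fun c x y => by
      rw [hl _ (c • σ x) (σ y) (by simp [hσ _])]; simp)
    (fun x y y' => by
      rw [hlr (σ x) (σ x) _ (σ y + σ y') rfl (by simp [hσ _])]; simp)
    (fun c x y => by
      rw [hlr (σ x) (σ x) _ (c • σ y) rfl (by simp [hσ _])]; simp)
  have hb : ∀ f g, b (p f) (p g) = p (P.bracket f g) := fun f g =>
    hlr _ _ _ _ (hσ _) (hσ _)
  refine ⟨⟨b, ?_, ?_, ?_⟩, hb, ?_⟩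
  · intro a
    obtain ⟨f, rfl⟩ := hp a
    rw [hb, P.self_eq_zero, map_zero]
  · intro x y z
    obtain ⟨f, rfl⟩ := hp x
    obtain ⟨g, rfl⟩ := hp y
    obtain ⟨h, rfl⟩ := hp z
    simp only [hb, ← map_add, P.jacobi, map_zero]
  · intro x y z
    obtain ⟨f, rfl⟩ := hp x
    obtain ⟨g, rfl⟩ := hp y
    obtain ⟨h, rfl⟩ := hp z
    simp only [hb, ← map_add, ← map_mul, P.leibniz]
  · intro R hR
    ext x y
    obtain ⟨f, rfl⟩ := hp x
    obtain ⟨g, rfl⟩ := hp y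
    rw [hR]
    exact (hb f g).symm

/-- The restriction of a Poisson bracket to a Lie subalgebra. -/
def restrict (P : PoissonBracket A) (S : Subalgebra ℝ A)
    (hS : Reduction.IsLieSubalgebra (fun f g => P.bracket f g) S) : PoissonBracket S where
  bracket := LinearMap.mk₂ ℝ (fun f g => ⟨P.bracket f g, hS f f.2 g g.2⟩)
    (fun _ _ _ => Subtype.ext (by simp)) (fun _ _ _ => Subtype.ext (by simp))
    (fun _ _ _ => Subtype.ext (by simp)) (fun _ _ _ => Subtype.ext (by simp))
  self_eq_zero a := Subtype.ext (P.self_eq_zero a)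
  jacobi a b c := Subtype.ext (P.jacobi a b c)
  leibniz a b c := Subtype.ext (P.leibniz a b c)

end PoissonBracket

namespace Reduction

/-! ### Reduction by a Lie subalgebra that normalises an ideal -/

section Algebra

variable {A : Type*} [CommRing A] [Algebra ℝ A] {S : Subalgebra ℝ A} {I : Ideal A}

lemma mem_interIdeal {f : S} : f ∈ interIdeal S I ↔ (f : A) ∈ I := Iff.rfl

lemma isPoissonIdeal_interIdeal {br : A → A → A} (hS : IsLieSubalgebra br S)
    (hn : (S : Set A) ⊆ lieNormaliser br I) : IsPoissonIdeal hS (interIdeal S I) :=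
  fun j hj f => hn f.2 j hj

variable (S I) in
/-- The canonical map from `S` to `(S + I) / I`. -/
def toSumQuotientAlgHom : S →ₐ[ℝ] sumQuotient S I :=
  ((Ideal.Quotient.mkₐ ℝ I).comp S.val).codRestrict _ (mk_mem_sumQuotient S I)

/-- The summand from `I` dies in the quotient, so elements of `S` alone represent all classes. -/
lemma mem_sumQuotient_iff {a : A ⧸ I} :
    a ∈ sumQuotient S I ↔ ∃ f ∈ S, Ideal.Quotient.mk I f = a := by
  constructor
  · rintro ⟨_, ⟨f, hf, i, hi, rfl⟩, rfl⟩
    refine ⟨f, hf, ?_⟩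
    change Ideal.Quotient.mk I f = Ideal.Quotient.mk I (f + i)
    rw [map_add, Ideal.Quotient.eq_zero_iff_mem.2 hi, add_zero]
  · rintro ⟨f, hf, rfl⟩
    exact mk_mem_sumQuotient S I ⟨f, hf⟩

lemma toSumQuotientAlgHom_surjective : Function.Surjective (toSumQuotientAlgHom S I) := by
  rintro ⟨a, ha⟩
  obtain ⟨f, hf, rfl⟩ := mem_sumQuotient_iff.1 ha
  exact ⟨⟨f, hf⟩, rfl⟩

lemma toSumQuotientAlgHom_eq_zero_iff {f : S} :
    toSumQuotientAlgHom S I f = 0 ↔ f ∈ interIdeal S I := by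
  rw [mem_interIdeal, ← Ideal.Quotient.eq_zero_iff_mem, ← Subtype.coe_inj]
  rfl

/-- The bracket restricted to `S` is pushed along the quotient map; its kernel `S ∩ I` is stable
because `S` normalises `I`. -/
theorem existsUnique_isInherited (P : PoissonBracket A) {br : A → A → A}
    (hbr : ∀ f g, P.bracket f g = br f g) (hS : IsLieSubalgebra br S)
    (hn : (S : Set A) ⊆ lieNormaliser br I) :
    ∃! R : PoissonBracket (S ⧸ interIdeal S I), IsInherited hS I R := by
  obtain rfl : (fun f g => P.bracket f g) = br := by ext f g; exact hbr f g
  exact (P.restrict S hS).existsUnique_push (Ideal.Quotient.mkₐ ℝ (interIdeal S I))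
    Ideal.Quotient.mk_surjective fun f g hf => Ideal.Quotient.eq_zero_iff_mem.2 <|
      hn g.2 f (mem_interIdeal.1 (Ideal.Quotient.eq_zero_iff_mem.1 hf))

/-- The map `S → (S + I) / I` is onto with the same kernel `S ∩ I`, so the bracket descends for the
same reason. -/
theorem existsUnique_isInduced (P : PoissonBracket A) {br : A → A → A}
    (hbr : ∀ f g, P.bracket f g = br f g) (hS : IsLieSubalgebra br S)
    (hn : (S : Set A) ⊆ lieNormaliser br I) :
    ∃! Q : PoissonBracket (sumQuotient S I), IsInduced hS I Q := by
  obtain rfl : (fun f g => P.bracket f g) = br := by ext f g; exact hbr f g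
  exact (P.restrict S hS).existsUnique_push (toSumQuotientAlgHom S I)
    toSumQuotientAlgHom_surjective fun f g hf => toSumQuotientAlgHom_eq_zero_iff.2 <|
      hn g.2 f (toSumQuotientAlgHom_eq_zero_iff.1 hf)

theorem exists_algEquiv_sumQuotient {br : A → A → A} (hS : IsLieSubalgebra br S) :
    ∃ e : (S ⧸ interIdeal S I) ≃ₐ[ℝ] sumQuotient S I,
      (∀ f, e (Ideal.Quotient.mk _ f) = toSumQuotient S I f) ∧
      ∀ R Q, IsInherited hS I R → IsInduced hS I Q →
        ∀ a b, e (R.bracket a b) = Q.bracket (e a) (e b) := by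
  let φ : (S ⧸ interIdeal S I) →ₐ[ℝ] sumQuotient S I :=
    Ideal.Quotient.liftₐ (interIdeal S I) (toSumQuotientAlgHom S I)
      fun f hf => toSumQuotientAlgHom_eq_zero_iff.2 hf
  have hφ : ∀ f, φ (Ideal.Quotient.mk _ f) = toSumQuotient S I f := fun f => rfl
  refine ⟨AlgEquiv.ofBijective φ ⟨?_, ?_⟩, hφ, ?_⟩
  · rw [injective_iff_map_eq_zero]
    intro a ha
    obtain ⟨f, rfl⟩ := Ideal.Quotient.mk_surjective a
    exact Ideal.Quotient.eq_zero_iff_mem.2 (toSumQuotientAlgHom_eq_zero_iff.1 ha)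
  · intro x
    obtain ⟨f, rfl⟩ := toSumQuotientAlgHom_surjective x
    exact ⟨Ideal.Quotient.mk _ f, rfl⟩
  · intro R Q hR hQ a b
    obtain ⟨f, rfl⟩ := Ideal.Quotient.mk_surjective a
    obtain ⟨g, rfl⟩ := Ideal.Quotient.mk_surjective b
    rw [hR f g]
    exact (hQ f g).symm

/-- Brackets induced from two Lie subalgebras in the normaliser of `I` agree on common classes. -/
theorem IsInduced.bracket_eq (P : PoissonBracket A) {br : A → A → A}
    (hbr : ∀ f g, P.bracket f g = br f g) {S' : Subalgebra ℝ A}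
    {hS : IsLieSubalgebra br S} {hS' : IsLieSubalgebra br S'}
    (hn : (S : Set A) ⊆ lieNormaliser br I) (hn' : (S' : Set A) ⊆ lieNormaliser br I)
    {Q : PoissonBracket (sumQuotient S I)} {Q' : PoissonBracket (sumQuotient S' I)}
    (hQ : IsInduced hS I Q) (hQ' : IsInduced hS' I Q') {a b : A ⧸ I}
    (ha : a ∈ sumQuotient S I) (hb : b ∈ sumQuotient S I)
    (ha' : a ∈ sumQuotient S' I) (hb' : b ∈ sumQuotient S' I) :
    (Q.bracket ⟨a, ha⟩ ⟨b, hb⟩ : A ⧸ I) = Q'.bracket ⟨a, ha'⟩ ⟨b, hb'⟩ := by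
  obtain rfl : (fun f g => P.bracket f g) = br := by ext f g; exact hbr f g
  obtain ⟨f, hf, rfl⟩ := mem_sumQuotient_iff.1 ha
  obtain ⟨g, hg, rfl⟩ := mem_sumQuotient_iff.1 hb
  obtain ⟨f', hf', hff'⟩ := mem_sumQuotient_iff.1 ha'
  obtain ⟨g', hg', hgg'⟩ := mem_sumQuotient_iff.1 hb'
  have h1 := congrArg Subtype.val (hQ ⟨f, hf⟩ ⟨g, hg⟩)
  have h2 := congrArg Subtype.val (hQ' ⟨f', hf'⟩ ⟨g', hg'⟩)
  have e1 : toSumQuotient S' I ⟨f', hf'⟩ = ⟨Ideal.Quotient.mk I f, ha'⟩ := Subtype.ext hff'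
  have e2 : toSumQuotient S' I ⟨g', hg'⟩ = ⟨Ideal.Quotient.mk I g, hb'⟩ := Subtype.ext hgg'
  rw [e1, e2] at h2
  refine h1.trans (Eq.trans ?_ h2.symm)
  change Ideal.Quotient.mk I (P.bracket f g) = Ideal.Quotient.mk I (P.bracket f' g')
  rw [Ideal.Quotient.eq]
  -- Representatives are changed one at a time, each difference being paired with an element known
  -- to normalise `I`: `g ∈ S` for `f - f'`, and `f' ∈ S'` for `g - g'`.
  have k1 : P.bracket (f - f') g ∈ I := hn hg _ (Ideal.Quotient.eq.1 hff'.symm)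
  have k2 : P.bracket (g - g') f' ∈ I := hn' hf' _ (Ideal.Quotient.eq.1 hgg'.symm)
  have : P.bracket f g - P.bracket f' g' = P.bracket (f - f') g - P.bracket (g - g') f' := by
    rw [P.antisymm (g - g') f']
    simp only [map_sub, LinearMap.sub_apply]
    abel
  rw [this]
  exact I.sub_mem k1 k2

end Algebra

open Filter Topology

section Calculus

variable {E : Type*} [NormedAddCommGroup E] [NormedSpace ℝ E]
  {M : Type*} [TopologicalSpace M] [ChartedSpace E M]

/-! ## Differentials -/

lemma diff_congr {f g : M → ℝ} {x : M} (h : f =ᶠ[𝓝 x] g) :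
    diff (E := E) f x = diff g x := h.mfderiv_eq

lemma diff_const (c : ℝ) (x : M) : diff (E := E) (fun _ : M => c) x = 0 := mfderiv_const

lemma diff_add {f g : M → ℝ} {x : M} (hf : MDifferentiableAt 𝓘(ℝ, E) 𝓘(ℝ) f x)
    (hg : MDifferentiableAt 𝓘(ℝ, E) 𝓘(ℝ) g x) :
    diff (E := E) (f + g) x = diff f x + diff g x :=
  (hf.hasMFDerivAt.add hg.hasMFDerivAt).mfderiv

lemma diff_smul {f : M → ℝ} {x : M} (c : ℝ) (hf : MDifferentiableAt 𝓘(ℝ, E) 𝓘(ℝ) f x) :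
    diff (E := E) (c • f) x = c • diff f x :=
  (hf.hasMFDerivAt.const_smul c).mfderiv

lemma diff_mul {f g : M → ℝ} {x : M} (hf : MDifferentiableAt 𝓘(ℝ, E) 𝓘(ℝ) f x)
    (hg : MDifferentiableAt 𝓘(ℝ, E) 𝓘(ℝ) g x) :
    diff (E := E) (f * g) x = f x • diff g x + g x • diff f x :=
  (hf.hasMFDerivAt.mul hg.hasMFDerivAt).mfderiv

lemma diff_coe_mul (f g : C^∞⟮𝓘(ℝ, E), M; ℝ⟯) (x : M) (v : TangentSpace 𝓘(ℝ, E) x) :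
    diff (E := E) (f * g : C^∞⟮𝓘(ℝ, E), M; ℝ⟯) x v = f x * diff g x v + g x * diff f x v := by
  have := diff_mul (f.contMDiff.mdifferentiable (by simp) x)
    (g.contMDiff.mdifferentiable (by simp) x)
  rw [ContMDiffMap.coe_mul, this]
  rfl

lemma diff_coe_add (f g : C^∞⟮𝓘(ℝ, E), M; ℝ⟯) (x : M) (v : TangentSpace 𝓘(ℝ, E) x) :
    diff (E := E) (f + g : C^∞⟮𝓘(ℝ, E), M; ℝ⟯) x v = diff f x v + diff g x v := by
  have := diff_add (f.contMDiff.mdifferentiable (by simp) x)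
    (g.contMDiff.mdifferentiable (by simp) x)
  rw [ContMDiffMap.coe_add, this]
  rfl

/-- The expression of a differential through the chart at `x`. -/
lemma diff_eq_comp {f : M → ℝ} {x y : M} (hy : y ∈ (chartAt E x).source)
    (hf : DifferentiableAt ℝ (f ∘ (extChartAt 𝓘(ℝ, E) x).symm) (extChartAt 𝓘(ℝ, E) x y))
    [IsManifold 𝓘(ℝ, E) ∞ M] :
    diff (E := E) f y =
      (fderiv ℝ (f ∘ (extChartAt 𝓘(ℝ, E) x).symm) (extChartAt 𝓘(ℝ, E) x y)).comp
        (mfderiv 𝓘(ℝ, E) 𝓘(ℝ, E) (extChartAt 𝓘(ℝ, E) x) y) := by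
  have : IsManifold 𝓘(ℝ, E) 1 M := .of_le (n := ∞) (by simp)
  have h : f =ᶠ[𝓝 y]
      (f ∘ (extChartAt 𝓘(ℝ, E) x).symm) ∘ (extChartAt 𝓘(ℝ, E) x) := by
    filter_upwards [(chartAt E x).open_source.mem_nhds hy] with z hz
    simp only [Function.comp_apply]
    rw [(extChartAt 𝓘(ℝ, E) x).left_inv (by simpa using hz)]
  rw [diff_congr h]
  unfold diff
  rw [mfderiv_comp (I' := 𝓘(ℝ, E)) y hf.mdifferentiableAt (mdifferentiableAt_extChartAt hy),
    mfderiv_eq_fderiv]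
  rfl

lemma diff_coordFun [IsManifold 𝓘(ℝ, E) ∞ M] {x y : M} (hy : y ∈ (chartAt E x).source)
    (α : E →L[ℝ] ℝ) :
    diff (E := E) (coordFun x α) y =
      α.comp (mfderiv 𝓘(ℝ, E) 𝓘(ℝ, E) (extChartAt 𝓘(ℝ, E) x) y) := by
  have : IsManifold 𝓘(ℝ, E) 1 M := .of_le (n := ∞) (by simp)
  change mfderiv 𝓘(ℝ, E) 𝓘(ℝ) (α ∘ extChartAt 𝓘(ℝ, E) x) y = _
  rw [mfderiv_comp (I' := 𝓘(ℝ, E)) y α.mdifferentiableAt (mdifferentiableAt_extChartAt hy),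
    ContinuousLinearMap.mfderiv_eq]
  rfl

lemma diff_coordFun_self [IsManifold 𝓘(ℝ, E) ∞ M] (x : M) (α : E →L[ℝ] ℝ) :
    diff (E := E) (coordFun x α) x = α := by
  have : IsManifold 𝓘(ℝ, E) 1 M := .of_le (n := ∞) (by simp)
  rw [diff_coordFun (mem_chart_source E x), mfderiv_extChartAt_self]
  rfl

/-- Replaces a function by a linear coordinate function with coefficients frozen at `y`; this
suffices wherever only the differential at `y` enters. -/
lemma diff_eq_diff_coordFun [IsManifold 𝓘(ℝ, E) ∞ M] {f : M → ℝ} {x y : M}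
    (hy : y ∈ (chartAt E x).source)
    (hf : DifferentiableAt ℝ (f ∘ (extChartAt 𝓘(ℝ, E) x).symm) (extChartAt 𝓘(ℝ, E) x y)) :
    diff (E := E) f y = diff (coordFun x
      (fderiv ℝ (f ∘ (extChartAt 𝓘(ℝ, E) x).symm) (extChartAt 𝓘(ℝ, E) x y))) y := by
  rw [diff_eq_comp hy hf, diff_coordFun hy]

lemma contMDiffOn_coordFun [IsManifold 𝓘(ℝ, E) ∞ M] (x : M) (α : E →L[ℝ] ℝ) :
    ContMDiffOn 𝓘(ℝ, E) 𝓘(ℝ) ∞ (coordFun x α) (chartAt E x).source :=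
  α.contMDiff.comp_contMDiffOn contMDiffOn_extChartAt

/-! ## Cut-off functions -/

section Bump

variable [FiniteDimensional ℝ E] [T2Space M] [IsManifold 𝓘(ℝ, E) ∞ M]

/-- A smooth cut-off function at `x`, supported in a given neighbourhood. -/
lemma exists_cutoff {x : M} {U : Set M} (hU : U ∈ 𝓝 x) :
    ∃ χ : C^∞⟮𝓘(ℝ, E), M; ℝ⟯, (χ =ᶠ[𝓝 x] fun _ => 1) ∧ tsupport χ ⊆ U := by
  obtain ⟨f, -, hf⟩ := (SmoothBumpFunction.nhds_basis_tsupport (I := 𝓘(ℝ, E)) x).mem_iff.1 hU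
  exact ⟨⟨f, f.contMDiff⟩, f.eventuallyEq_one, hf⟩

/-- Every germ of a smooth function is the germ of a global one. -/
lemma exists_contMDiffMap_eventuallyEq {f : M → ℝ} {x : M} {U : Set M} (hU : IsOpen U)
    (hx : x ∈ U) (hf : ContMDiffOn 𝓘(ℝ, E) 𝓘(ℝ) ∞ f U) :
    ∃ F : C^∞⟮𝓘(ℝ, E), M; ℝ⟯, F =ᶠ[𝓝 x] f := by
  obtain ⟨χ, h1, h2⟩ := exists_cutoff (E := E) (hU.mem_nhds hx)
  refine ⟨⟨fun y => χ y • f y, contMDiff_of_tsupport fun y hy => ?_⟩, ?_⟩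
  · exact χ.contMDiff.contMDiffAt.smul
      (hf.contMDiffAt (hU.mem_nhds (h2 (tsupport_smul_subset_left _ _ hy))))
  · filter_upwards [h1] with y hy
    change χ y • f y = f y
    rw [hy, one_smul]

/-- Every cotangent vector is the differential of a smooth function. -/
lemma exists_diff_eq (x : M) (α : E →L[ℝ] ℝ) :
    ∃ F : C^∞⟮𝓘(ℝ, E), M; ℝ⟯, diff (E := E) F x = α := by
  obtain ⟨F, hF⟩ := exists_contMDiffMap_eventuallyEq (E := E) (chartAt E x).open_source
    (mem_chart_source E x) (contMDiffOn_coordFun (E := E) x α)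
  exact ⟨F, (diff_congr hF).trans (diff_coordFun_self x α)⟩

lemma exists_diff_apply_ne_zero {x : M} {v : TangentSpace 𝓘(ℝ, E) x} (hv : v ≠ 0) :
    ∃ F : C^∞⟮𝓘(ℝ, E), M; ℝ⟯, diff (E := E) F x v ≠ 0 := by
  have : ∃ α : E →L[ℝ] ℝ, α v ≠ 0 := by
    by_contra! h
    exact hv (SeparatingDual.eq_zero_of_forall_dual_eq_zero (R := ℝ) (V := E) h)
  obtain ⟨α, hα⟩ := this
  obtain ⟨F, hF⟩ := exists_diff_eq x α
  exact ⟨F, by rw [hF]; exact hα⟩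

end Bump

end Calculus

/-! ## The Jacobi identity in a vector space -/

section Jacobi

variable {E : Type*} [NormedAddCommGroup E] [NormedSpace ℝ E]

/-- The bracket of functions on an open subset of `E` given by a field of bilinear forms. -/
noncomputable def vbracket (p : E → (E →L[ℝ] ℝ) →L[ℝ] (E →L[ℝ] ℝ) →L[ℝ] ℝ) (f g : E → ℝ) (z : E) :
    ℝ :=
  p z (fderiv ℝ f z) (fderiv ℝ g z)

/-- The Jacobiator of an alternating field of bilinear forms only depends on the differentials of
the functions, as the second derivatives cancel. -/
theorem jacobiator_vbracket_eq [FiniteDimensional ℝ E]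
    {p : E → (E →L[ℝ] ℝ) →L[ℝ] (E →L[ℝ] ℝ) →L[ℝ] ℝ}
    {z : E} (hp : DifferentiableAt ℝ p z) (halt : ∀ ξ, p z ξ ξ = 0) {f g h : E → ℝ}
    (hf : ContDiffAt ℝ 2 f z) (hg : ContDiffAt ℝ 2 g z) (hh : ContDiffAt ℝ 2 h z) :
    vbracket p f (vbracket p g h) z + vbracket p g (vbracket p h f) z
        + vbracket p h (vbracket p f g) z =
      p z (fderiv ℝ f z) (fderiv ℝ (fun y => p y (fderiv ℝ g z) (fderiv ℝ h z)) z)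
      + p z (fderiv ℝ g z) (fderiv ℝ (fun y => p y (fderiv ℝ h z) (fderiv ℝ f z)) z)
      + p z (fderiv ℝ h z) (fderiv ℝ (fun y => p y (fderiv ℝ f z) (fderiv ℝ g z)) z) := by
  have hanti : ∀ ξ η, p z ξ η = - p z η ξ := by
    intro ξ η
    have := halt (ξ + η)
    simp only [map_add, add_apply, halt, zero_add, add_zero] at this
    linarith
  -- Finite dimension makes `E` reflexive, so the functional `p z ξ` is evaluation at a vector: the
  -- value of the Hamiltonian vector field.
  have hsharp : ∀ ξ, ∃ v : E, ∀ η, p z ξ η = η v := by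
    intro ξ
    let T : Module.Dual ℝ (Module.Dual ℝ E) :=
      (p z ξ).toLinearMap ∘ₗ
        (LinearMap.toContinuousLinearMap (𝕜 := ℝ) (E := E) (F' := ℝ)).toLinearMap
    refine ⟨(Module.evalEquiv ℝ E).symm T, fun η => ?_⟩
    exact (Module.apply_evalEquiv_symm_apply ℝ E η.toLinearMap T).symm
  have key : ∀ {g h : E → ℝ}, ContDiffAt ℝ 2 g z → ContDiffAt ℝ 2 h z → ∀ v,
      fderiv ℝ (vbracket p g h) z v =
        fderiv ℝ (fun y => p y (fderiv ℝ g z) (fderiv ℝ h z)) z v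
        + p z (fderiv ℝ (fderiv ℝ g) z v) (fderiv ℝ h z)
        + p z (fderiv ℝ g z) (fderiv ℝ (fderiv ℝ h) z v) := by
    intro g h hg hh v
    have hg' : DifferentiableAt ℝ (fderiv ℝ g) z :=
      (hg.fderiv_right (m := 1) (by norm_num)).differentiableAt (by simp)
    have hh' : DifferentiableAt ℝ (fderiv ℝ h) z :=
      (hh.fderiv_right (m := 1) (by norm_num)).differentiableAt (by simp)
    have e1 : HasFDerivAt (vbracket p g h) _ z :=
      (hp.hasFDerivAt.clm_apply hg'.hasFDerivAt).clm_apply hh'.hasFDerivAt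
    have e2 := (hp.hasFDerivAt.clm_apply (hasFDerivAt_const (fderiv ℝ g z) z)).clm_apply
      (hasFDerivAt_const (fderiv ℝ h z) z)
    rw [e1.fderiv, e2.fderiv]
    simp
    ring
  have hsymm : ∀ {g : E → ℝ}, ContDiffAt ℝ 2 g z → ∀ v w,
      fderiv ℝ (fderiv ℝ g) z v w = fderiv ℝ (fderiv ℝ g) z w v := by
    intro g hg v w
    exact hg.isSymmSndFDerivAt (by simp) v w
  obtain ⟨a, ha⟩ := hsharp (fderiv ℝ f z)
  obtain ⟨b, hb⟩ := hsharp (fderiv ℝ g z)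
  obtain ⟨c, hc⟩ := hsharp (fderiv ℝ h z)
  have e1 : vbracket p f (vbracket p g h) z = _ := (ha _).trans (key hg hh a)
  have e2 : vbracket p g (vbracket p h f) z = _ := (hb _).trans (key hh hf b)
  have e3 : vbracket p h (vbracket p f g) z = _ := (hc _).trans (key hf hg c)
  -- With the Hamiltonian vectors `a, b, c`, the six second-order terms become `± D²f(b, c)`, `±
  -- D²g(a, c)`, `± D²h(a, b)` and cancel in pairs by symmetry of second derivatives.
  rw [e1, e2, e3, ha, hb, hc, hanti _ (fderiv ℝ h z), hanti _ (fderiv ℝ f z),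
    hanti _ (fderiv ℝ g z), ha, hb, hc, ha, hb, hc, hsymm hg a c, hsymm hh b a, hsymm hf c b]
  ring

end Jacobi

/-! ## The Poisson algebra of a Poisson manifold -/

namespace BivectorField

variable {E : Type*} [NormedAddCommGroup E] [NormedSpace ℝ E]
  {M : Type*} [TopologicalSpace M] [ChartedSpace E M] [IsManifold 𝓘(ℝ, E) ∞ M]
  (P : BivectorField E M)

lemma bracket_apply (f g : C^∞⟮𝓘(ℝ, E), M; ℝ⟯) (x : M) :
    P.bracket f g x = P.toFun x (diff f x) (diff g x) := rfl

lemma pairing_congr {f f' g g' : M → ℝ} {x : M} (hf : f =ᶠ[𝓝 x] f') (hg : g =ᶠ[𝓝 x] g') :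
    P.pairing f g x = P.pairing f' g' x := by
  unfold pairing
  rw [diff_congr hf, diff_congr hg]

lemma pairing_eventuallyEq {f f' g g' : M → ℝ} {x : M} (hf : f =ᶠ[𝓝 x] f')
    (hg : g =ᶠ[𝓝 x] g') : P.pairing f g =ᶠ[𝓝 x] P.pairing f' g' := by
  filter_upwards [hf.eventuallyEq_nhds, hg.eventuallyEq_nhds] with y h1 h2
  exact P.pairing_congr h1 h2

/-- The pairing at a point depends only on germs, and every smooth germ comes from a global
function, for which smoothness is known. -/
lemma contMDiffOn_pairing [FiniteDimensional ℝ E] [T2Space M] {f g : M → ℝ} {U : Set M}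
    (hU : IsOpen U) (hf : ContMDiffOn 𝓘(ℝ, E) 𝓘(ℝ) ∞ f U)
    (hg : ContMDiffOn 𝓘(ℝ, E) 𝓘(ℝ) ∞ g U) : ContMDiffOn 𝓘(ℝ, E) 𝓘(ℝ) ∞ (P.pairing f g) U := by
  intro x hx
  obtain ⟨F, hF⟩ := exists_contMDiffMap_eventuallyEq hU hx hf
  obtain ⟨G, hG⟩ := exists_contMDiffMap_eventuallyEq hU hx hg
  exact ((P.contMDiff_pairing F G).contMDiffAt.congr_of_eventuallyEq
    (P.pairing_eventuallyEq hF hG).symm).contMDiffWithinAt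

/-- The bivector field in the chart at `x`. -/
noncomputable def inChart (x : M) (z : E) : (E →L[ℝ] ℝ) →L[ℝ] (E →L[ℝ] ℝ) →L[ℝ] ℝ :=
  let y := (extChartAt 𝓘(ℝ, E) x).symm z
  let L : (E →L[ℝ] ℝ) →L[ℝ] (E →L[ℝ] ℝ) :=
    (ContinuousLinearMap.compL ℝ E E ℝ).flip
      (mfderiv 𝓘(ℝ, E) 𝓘(ℝ, E) (extChartAt 𝓘(ℝ, E) x) y : E →L[ℝ] E)
  ContinuousLinearMap.bilinearComp (E := E →L[ℝ] ℝ) (F := E →L[ℝ] ℝ) (P.toFun y) L L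

lemma inChart_apply (x : M) {z : E} (hz : z ∈ (extChartAt 𝓘(ℝ, E) x).target) (ξ η : E →L[ℝ] ℝ) :
    P.inChart x z ξ η =
      P.pairing (coordFun x ξ) (coordFun x η) ((extChartAt 𝓘(ℝ, E) x).symm z) := by
  have hy : (extChartAt 𝓘(ℝ, E) x).symm z ∈ (chartAt E x).source := by
    simpa using (extChartAt 𝓘(ℝ, E) x).map_target hz
  unfold pairing
  rw [diff_coordFun hy, diff_coordFun hy]
  rfl

lemma pairing_symm_eq_vbracket {x : M} {z : E} (hz : z ∈ (extChartAt 𝓘(ℝ, E) x).target)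
    {f g : M → ℝ} (hf : DifferentiableAt ℝ (f ∘ (extChartAt 𝓘(ℝ, E) x).symm) z)
    (hg : DifferentiableAt ℝ (g ∘ (extChartAt 𝓘(ℝ, E) x).symm) z) :
    P.pairing f g ((extChartAt 𝓘(ℝ, E) x).symm z) =
      vbracket (P.inChart x) (f ∘ (extChartAt 𝓘(ℝ, E) x).symm)
        (g ∘ (extChartAt 𝓘(ℝ, E) x).symm) z := by
  have hy : (extChartAt 𝓘(ℝ, E) x).symm z ∈ (chartAt E x).source := by
    simpa using (extChartAt 𝓘(ℝ, E) x).map_target hz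
  have hz' := (extChartAt 𝓘(ℝ, E) x).right_inv hz
  rw [vbracket, P.inChart_apply x hz]
  unfold pairing
  rw [diff_eq_diff_coordFun (f := f) hy (by rwa [hz']),
    diff_eq_diff_coordFun (f := g) hy (by rwa [hz']), hz']

lemma contDiffOn_comp_extChartAt_symm {x : M} {f : M → ℝ}
    (hf : ContMDiffOn 𝓘(ℝ, E) 𝓘(ℝ) ∞ f (chartAt E x).source) :
    ContDiffOn ℝ ∞ (f ∘ (extChartAt 𝓘(ℝ, E) x).symm) (extChartAt 𝓘(ℝ, E) x).target := by
  rw [← contMDiffOn_iff_contDiffOn]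
  exact hf.comp (contMDiffOn_extChartAt_symm x) fun z hz => by
    simpa using (extChartAt 𝓘(ℝ, E) x).map_target hz

/-- In finite dimension smoothness may be tested on fixed covectors, where the value is the pairing
of two coordinate functions. -/
lemma contDiffOn_inChart [FiniteDimensional ℝ E] [T2Space M] (x : M) :
    ContDiffOn ℝ ∞ (P.inChart x) (extChartAt 𝓘(ℝ, E) x).target := by
  refine contDiffOn_clm_apply.2 fun ξ => contDiffOn_clm_apply.2 fun η => ?_
  refine (contDiffOn_comp_extChartAt_symm (P.contMDiffOn_pairing (chartAt E x).open_source
    (contMDiffOn_coordFun x ξ) (contMDiffOn_coordFun x η))).congr fun z hz => ?_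
  exact P.inChart_apply x hz ξ η

lemma diff_eq_fderiv {x : M} {f : M → ℝ}
    (hf : DifferentiableAt ℝ (f ∘ (extChartAt 𝓘(ℝ, E) x).symm) (extChartAt 𝓘(ℝ, E) x x)) :
    diff (E := E) f x =
      fderiv ℝ (f ∘ (extChartAt 𝓘(ℝ, E) x).symm) (extChartAt 𝓘(ℝ, E) x x) := by
  rw [diff_eq_diff_coordFun (mem_chart_source E x) hf, diff_coordFun_self]

lemma contDiffAt_comp_extChartAt_symm {x : M} {f : M → ℝ}
    (hf : ContMDiffOn 𝓘(ℝ, E) 𝓘(ℝ) ∞ f (chartAt E x).source) {z : E}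
    (hz : z ∈ (extChartAt 𝓘(ℝ, E) x).target) :
    ContDiffAt ℝ ∞ (f ∘ (extChartAt 𝓘(ℝ, E) x).symm) z :=
  (contDiffOn_comp_extChartAt_symm hf).contDiffAt
    ((isOpen_extChartAt_target x).mem_nhds hz)

lemma pairing_pairing_eq_vbracket [FiniteDimensional ℝ E] [T2Space M] (x : M) {f g h : M → ℝ}
    (hf : ContMDiffOn 𝓘(ℝ, E) 𝓘(ℝ) ∞ f (chartAt E x).source)
    (hg : ContMDiffOn 𝓘(ℝ, E) 𝓘(ℝ) ∞ g (chartAt E x).source)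
    (hh : ContMDiffOn 𝓘(ℝ, E) 𝓘(ℝ) ∞ h (chartAt E x).source) :
    P.pairing f (P.pairing g h) x =
      vbracket (P.inChart x) (f ∘ (extChartAt 𝓘(ℝ, E) x).symm)
        (vbracket (P.inChart x) (g ∘ (extChartAt 𝓘(ℝ, E) x).symm)
          (h ∘ (extChartAt 𝓘(ℝ, E) x).symm)) (extChartAt 𝓘(ℝ, E) x x) := by
  have hx := mem_extChartAt_target (I := 𝓘(ℝ, E)) x
  have hd : ∀ {u : M → ℝ}, ContMDiffOn 𝓘(ℝ, E) 𝓘(ℝ) ∞ u (chartAt E x).source →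
      ∀ {z}, z ∈ (extChartAt 𝓘(ℝ, E) x).target →
        DifferentiableAt ℝ (u ∘ (extChartAt 𝓘(ℝ, E) x).symm) z := fun hu _ hz =>
    (contDiffAt_comp_extChartAt_symm hu hz).differentiableAt (by simp)
  have hgh := P.contMDiffOn_pairing (chartAt E x).open_source hg hh
  have e : (P.pairing g h) ∘ (extChartAt 𝓘(ℝ, E) x).symm =ᶠ[𝓝 (extChartAt 𝓘(ℝ, E) x x)]
      vbracket (P.inChart x) (g ∘ (extChartAt 𝓘(ℝ, E) x).symm)
          (h ∘ (extChartAt 𝓘(ℝ, E) x).symm) := by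
    filter_upwards [(isOpen_extChartAt_target (I := 𝓘(ℝ, E)) x).mem_nhds hx] with z hz
    exact P.pairing_symm_eq_vbracket hz (hd hg hz) (hd hh hz)
  have := P.pairing_symm_eq_vbracket hx (hd hf hx) (hd hgh hx)
  rw [extChartAt_to_inv] at this
  rw [this, vbracket, vbracket, e.fderiv_eq]

/-- The Jacobiator of smooth functions in the chart at a point. -/
lemma jacobiator_eq_inChart [FiniteDimensional ℝ E] [T2Space M] (x : M) {f g h : M → ℝ}
    (hf : ContMDiffOn 𝓘(ℝ, E) 𝓘(ℝ) ∞ f (chartAt E x).source)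
    (hg : ContMDiffOn 𝓘(ℝ, E) 𝓘(ℝ) ∞ g (chartAt E x).source)
    (hh : ContMDiffOn 𝓘(ℝ, E) 𝓘(ℝ) ∞ h (chartAt E x).source) {α β γ : E →L[ℝ] ℝ}
    (hα : diff f x = α) (hβ : diff g x = β) (hγ : diff h x = γ) :
    P.pairing f (P.pairing g h) x + P.pairing g (P.pairing h f) x
        + P.pairing h (P.pairing f g) x =
      P.inChart x (extChartAt 𝓘(ℝ, E) x x) α
          (fderiv ℝ (fun y => P.inChart x y β γ) (extChartAt 𝓘(ℝ, E) x x))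
        + P.inChart x (extChartAt 𝓘(ℝ, E) x x) β
          (fderiv ℝ (fun y => P.inChart x y γ α) (extChartAt 𝓘(ℝ, E) x x))
        + P.inChart x (extChartAt 𝓘(ℝ, E) x x) γ
          (fderiv ℝ (fun y => P.inChart x y α β) (extChartAt 𝓘(ℝ, E) x x)) := by
  have hx := mem_extChartAt_target (I := 𝓘(ℝ, E)) x
  have hp : DifferentiableAt ℝ (P.inChart x) (extChartAt 𝓘(ℝ, E) x x) :=
    ((P.contDiffOn_inChart x).contDiffAt
      ((isOpen_extChartAt_target x).mem_nhds hx)).differentiableAt (by simp)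
  have halt : ∀ ξ, P.inChart x (extChartAt 𝓘(ℝ, E) x x) ξ ξ = 0 := fun ξ => by
    rw [P.inChart_apply x hx]
    exact P.alt _ _
  have hc : ∀ {u : M → ℝ}, ContMDiffOn 𝓘(ℝ, E) 𝓘(ℝ) ∞ u (chartAt E x).source →
      ContDiffAt ℝ 2 (u ∘ (extChartAt 𝓘(ℝ, E) x).symm) (extChartAt 𝓘(ℝ, E) x x) := fun hu =>
    (contDiffAt_comp_extChartAt_symm hu hx).of_le ENat.LEInfty.out
  have hd : ∀ {u : M → ℝ}, ContMDiffOn 𝓘(ℝ, E) 𝓘(ℝ) ∞ u (chartAt E x).source →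
      fderiv ℝ (u ∘ (extChartAt 𝓘(ℝ, E) x).symm) (extChartAt 𝓘(ℝ, E) x x) = diff (E := E) u x :=
    fun hu => (diff_eq_fderiv ((hc hu).differentiableAt (by simp))).symm
  have key := jacobiator_vbracket_eq hp halt (hc hf) (hc hg) (hc hh)
  rw [(hd hf).trans hα, (hd hg).trans hβ, (hd hh).trans hγ] at key
  rw [P.pairing_pairing_eq_vbracket x hf hg hh, P.pairing_pairing_eq_vbracket x hg hh hf,
    P.pairing_pairing_eq_vbracket x hh hf hg]
  exact key

/-- The expression in `jacobiator_eq_inChart` sees `f, g, h` only through their differentials at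
`x`, and the coordinate functions have the same ones. -/
lemma jacobiator_eq_schouten [FiniteDimensional ℝ E] [T2Space M] (x : M) {f g h : M → ℝ}
    (hf : ContMDiffOn 𝓘(ℝ, E) 𝓘(ℝ) ∞ f (chartAt E x).source)
    (hg : ContMDiffOn 𝓘(ℝ, E) 𝓘(ℝ) ∞ g (chartAt E x).source)
    (hh : ContMDiffOn 𝓘(ℝ, E) 𝓘(ℝ) ∞ h (chartAt E x).source) :
    P.pairing f (P.pairing g h) x + P.pairing g (P.pairing h f) x
        + P.pairing h (P.pairing f g) x = P.schouten x (diff f x) (diff g x) (diff h x) :=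
  (P.jacobiator_eq_inChart x hf hg hh rfl rfl rfl).trans
    (P.jacobiator_eq_inChart x (contMDiffOn_coordFun x _) (contMDiffOn_coordFun x _)
      (contMDiffOn_coordFun x _) (diff_coordFun_self x _) (diff_coordFun_self x _)
      (diff_coordFun_self x _)).symm

/-- The Poisson bracket on `C^∞(M)` of a Poisson bivector field. -/
noncomputable def poissonBracket [FiniteDimensional ℝ E] [T2Space M] (hP : P.IsPoisson) :
    PoissonBracket C^∞⟮𝓘(ℝ, E), M; ℝ⟯ where
  bracket := LinearMap.mk₂ ℝ P.bracket
    (fun f f' g => by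
      ext x
      have := diff_add (f.contMDiff.mdifferentiable (by simp) x)
        (f'.contMDiff.mdifferentiable (by simp) x)
      simp [bracket_apply, this])
    (fun c f g => by
      ext x
      have := diff_smul c (f.contMDiff.mdifferentiable (by simp) x)
      simp [bracket_apply, this])
    (fun f g g' => by
      ext x
      have := diff_add (g.contMDiff.mdifferentiable (by simp) x)
        (g'.contMDiff.mdifferentiable (by simp) x)
      simp [bracket_apply, this])
    (fun c f g => by
      ext x
      have := diff_smul c (g.contMDiff.mdifferentiable (by simp) x)
      simp [bracket_apply, this])
  self_eq_zero f := by
    ext x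
    exact P.alt x _
  jacobi f g h := by
    ext x
    exact (P.jacobiator_eq_schouten x f.contMDiff.contMDiffOn g.contMDiff.contMDiffOn
      h.contMDiff.contMDiffOn).trans (hP _ _ _ _)
  leibniz f g h := by
    ext x
    have := diff_mul (g.contMDiff.mdifferentiable (by simp) x)
        (h.contMDiff.mdifferentiable (by simp) x)
    simp [bracket_apply, this]
    ring

lemma poissonBracket_apply [FiniteDimensional ℝ E] [T2Space M] (hP : P.IsPoisson)
    (f g : C^∞⟮𝓘(ℝ, E), M; ℝ⟯) : (P.poissonBracket hP).bracket f g = P.bracket f g := rfl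

end BivectorField

section Submanifold

variable {E : Type*} [NormedAddCommGroup E] [NormedSpace ℝ E]
  {M : Type*} [TopologicalSpace M] [ChartedSpace E M] {N : Type*} {ι : N → M}

lemma mem_vanishingIdeal {f : C^∞⟮𝓘(ℝ, E), M; ℝ⟯} : f ∈ vanishingIdeal ι ↔ ∀ q, f (ι q) = 0 :=
  Iff.rfl

variable [IsManifold 𝓘(ℝ, E) ∞ M]
  {E' : Type*} [NormedAddCommGroup E'] [NormedSpace ℝ E']
  [TopologicalSpace N] [ChartedSpace E' N]
  {B : ∀ q : N, Submodule ℝ (TangentSpace 𝓘(ℝ, E) (ι q))} {r : ℕ}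

/-! ## Functions annihilated by a subbundle -/

lemma IsSubbundle.finrank_eq (hB : IsSubbundle E' ι r B) (q : N) :
    Module.finrank ℝ (B q) = r := by
  obtain ⟨U, -, hq, s, -, hs⟩ := hB q
  rw [← (hs q hq).2, finrank_span_eq_card (hs q hq).1, Fintype.card_fin]

/-- The rank `r` is the same at all points, so a zero fibre anywhere would force `r = 0`. -/
lemma IsSubbundle.ne_bot (hB : IsSubbundle E' ι r B) (h : ∃ q, B q ≠ ⊥)
    (q : N) : B q ≠ ⊥ := by
  obtain ⟨p, hp⟩ := h
  intro hq
  obtain ⟨U, -, hpU, s, -, hs⟩ := hB p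
  have hr : r = 0 := by rw [← hB.finrank_eq q, hq, finrank_bot]
  subst hr
  apply hp
  rw [← (hs p hpU).2]
  simp

/-- Multiplication of a local section of `T_N M` by a cut-off function gives a global one. -/
lemma IsSmoothSectionOn.smul_of_tsupport_subset {s : ∀ q : N, TangentSpace 𝓘(ℝ, E) (ι q)}
    {U : Set N} (hι : ContMDiff 𝓘(ℝ, E') 𝓘(ℝ, E) ∞ ι) (hs : IsSmoothSectionOn E' ι s U)
    (hU : IsOpen U) (χ : C^∞⟮𝓘(ℝ, E'), N; ℝ⟯) (hχ : tsupport χ ⊆ U) :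
    IsSmoothSectionOn E' ι (fun q => χ q • s q) Set.univ := by
  rw [IsSmoothSectionOn, contMDiffOn_univ]
  intro q
  by_cases hq : q ∈ tsupport χ
  · have h := hs.contMDiffAt (hU.mem_nhds (hχ hq))
    rw [Bundle.contMDiffAt_totalSpace] at h ⊢
    refine ⟨h.1, ?_⟩
    refine (χ.contMDiff.contMDiffAt.smul h.2).congr_of_eventuallyEq ?_
    let e := trivializationAt E (TangentSpace 𝓘(ℝ, E) (M := M)) (ι q)
    filter_upwards [hι.continuous.continuousAt.preimage_mem_nhds
      (e.open_baseSet.mem_nhds (mem_baseSet_trivializationAt E _ (ι q)))] with p hp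
    -- The trivialization is linear on fibres, so in it the product is a product of smooth
    -- functions.
    exact (e.linear ℝ hp).map_smul (χ p) (s p)
  · have h0 := ((Bundle.contMDiff_zeroSection ℝ (TangentSpace 𝓘(ℝ, E) (M := M)) (n := ∞)
      (IB := 𝓘(ℝ, E)) (F := E)).comp hι) q
    refine h0.congr_of_eventuallyEq ?_
    filter_upwards [(isClosed_tsupport χ).isOpen_compl.mem_nhds hq] with p hp
    simp [Bundle.zeroSection, image_eq_zero_of_notMem_tsupport hp]

/-- Functions annihilated by the global sections of a subbundle are annihilated by all its
vectors. -/
lemma mem_annihilated_iff [FiniteDimensional ℝ E'] [T2Space N] [IsManifold 𝓘(ℝ, E') ∞ N]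
    (hι : ContMDiff 𝓘(ℝ, E') 𝓘(ℝ, E) ∞ ι) (hB : IsSubbundle E' ι r B)
    {f : C^∞⟮𝓘(ℝ, E), M; ℝ⟯} :
    f ∈ annihilated E' ι B ↔ ∀ q, ∀ v ∈ B q, diff f (ι q) v = 0 := by
  refine ⟨fun hf q v hv => ?_, fun hf X hX q => hf q _ (hX.2 q)⟩
  obtain ⟨U, hU, hq, s, hs, hs'⟩ := hB q
  obtain ⟨χ, h1, h2⟩ := exists_cutoff (E := E') (hU.mem_nhds hq)
  rw [← (hs' q hq).2] at hv
  have hle : Submodule.span ℝ (Set.range fun i => s i q) ≤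
      LinearMap.ker (diff (E := E) f (ι q)).toLinearMap := by
    rw [Submodule.span_le]
    rintro _ ⟨i, rfl⟩
    -- The cut-off frame section is a global section of `B` whose value at `q` is `s i q`.
    have := hf (fun p => χ p • s i p) ⟨(hs i).smul_of_tsupport_subset hι hU χ h2, fun p => ?_⟩ q
    · simpa [h1.self_of_nhds] using this
    · by_cases hp : p ∈ U
      · rw [← (hs' p hp).2]
        exact Submodule.smul_mem _ _ (Submodule.subset_span ⟨i, rfl⟩)
      · simp [image_eq_zero_of_notMem_tsupport (fun h => hp (h2 h))]
  exact hle hv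

/-! ## Annihilated functions normalise the vanishing ideal -/

lemma BivectorField.bracket_mul_left (P : BivectorField E M) (f g h : C^∞⟮𝓘(ℝ, E), M; ℝ⟯) :
    P.bracket (f * g) h = f * P.bracket g h + g * P.bracket f h := by
  ext x
  have := diff_mul (f.contMDiff.mdifferentiable (by simp) x)
    (g.contMDiff.mdifferentiable (by simp) x)
  simp [bracket_apply, this]

/-- Products of two elements of the vanishing ideal are always annihilated by `B`, which settles the
closure of the set `W` where `B` detects that ideal. Off this closure, cut-off elements of the ideal
are themselves annihilated, and `B ≠ 0` is used there. -/
theorem annihilated_subset_lieNormaliser [FiniteDimensional ℝ E] [T2Space M]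
    [FiniteDimensional ℝ E'] [IsManifold 𝓘(ℝ, E') ∞ N] (P : BivectorField E M)
    (hι : Manifold.IsSmoothEmbedding 𝓘(ℝ, E') 𝓘(ℝ, E) ∞ ι)
    (hB : IsSubbundle E' ι r B) (hB0 : ∃ q, B q ≠ ⊥)
    (hLie : IsLieSubalgebra P.bracket (annihilated E' ι B)) :
    (annihilated E' ι B : Set C^∞⟮𝓘(ℝ, E), M; ℝ⟯) ⊆
      lieNormaliser P.bracket (vanishingIdeal ι) := by
  have : T2Space N := hι.isEmbedding.t2Space
  have hmem {f} := mem_annihilated_iff (f := f) hι.contMDiff hB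
  intro g hg f hf q
  let W : Set N := {q | ∃ f ∈ vanishingIdeal (E := E) ι, ∃ v ∈ B q, diff (E := E) f (ι q) v ≠ 0}
  have hsq : ∀ f₁ ∈ vanishingIdeal (E := E) ι, ∀ f₂ ∈ vanishingIdeal (E := E) ι, ∀ p, ∀ v ∈ B p,
      diff (E := E) f₁ (ι p) v * P.bracket f₂ g (ι p)
        + diff (E := E) f₂ (ι p) v * P.bracket f₁ g (ι p) = 0 := by
    intro f₁ h₁ f₂ h₂ p v hv
    have hm : f₁ * f₂ ∈ annihilated E' ι B := hmem.2 fun p v _ => by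
      rw [diff_coe_mul, h₁ p, h₂ p, zero_mul, zero_mul, add_zero]
    have := hmem.1 (hLie _ hm g hg) p v hv
    rw [P.bracket_mul_left, diff_coe_add, diff_coe_mul, diff_coe_mul, h₁ p, h₂ p] at this
    linarith
  have hW : ∀ p ∈ W, P.bracket f g (ι p) = 0 := by
    rintro p ⟨k, hk, v, hv, hne⟩
    -- Polarisation: the identity for the pair `k, k` kills `{k, g}`, and then the pair `k, f` kills
    -- `{f, g}`.
    have h1 : P.bracket k g (ι p) = 0 := by
      have := hsq k hk k hk p v hv
      rw [← two_mul] at this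
      simpa [hne] using this
    have := hsq k hk f hf p v hv
    simpa [h1, hne] using this
  by_cases hq : q ∈ closure W
  · have hcl : IsClosed {p : N | P.bracket f g (ι p) = 0} :=
      isClosed_eq ((P.bracket f g).contMDiff.continuous.comp hι.isEmbedding.continuous)
        continuous_const
    exact closure_minimal hW hcl hq
  -- As `N` carries the subspace topology, the complement of `closure W` is cut out by an open set
  -- of `M`, in which a cut-off on `M` can be supported.
  · obtain ⟨V, hV, hVW⟩ := hι.isEmbedding.isOpen_iff.1 (isClosed_closure (s := W)).isOpen_compl
    obtain ⟨χ, h1, h2⟩ := exists_cutoff (E := E) (hV.mem_nhds (x := ι q)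
      (by rw [← Set.mem_preimage, hVW]; exact hq))
    have hχ : ∀ k ∈ vanishingIdeal (E := E) ι, χ * k ∈ annihilated E' ι B := by
      intro k hk
      refine hmem.2 fun p v hv => ?_
      by_cases hp : p ∈ closure W
      · have hp' : ι p ∉ tsupport χ := fun h => by
          have : p ∈ ι ⁻¹' V := h2 h
          rw [hVW] at this
          exact this hp
        have : (χ * k : C^∞⟮𝓘(ℝ, E), M; ℝ⟯) =ᶠ[𝓝 (ι p)] fun _ => (0 : ℝ) := by
          filter_upwards [(isClosed_tsupport χ).isOpen_compl.mem_nhds hp'] with y hy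
          simp [image_eq_zero_of_notMem_tsupport hy]
        rw [diff_congr this, diff_const]
        rfl
      · by_contra hne
        exact hp (subset_closure ⟨χ * k, Ideal.mul_mem_left _ _ hk, v, hv, hne⟩)
    obtain ⟨v, hv, hv0⟩ := (Submodule.ne_bot_iff _).1 (hB.ne_bot hB0 q)
    obtain ⟨h, hh⟩ := exists_diff_apply_ne_zero hv0
    have hf' := hχ f hf
    have hhf : h * (χ * f) ∈ annihilated E' ι B := by
      rw [mul_left_comm]
      exact hχ _ (Ideal.mul_mem_left _ _ hf)
    -- In the expansion of `d{h χ f, g}(v)` at `q` only `dh(v) {χ f, g}` survives; there `{χ f, g} =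
    -- {f, g}`, because `χ = 1` and `f = 0`.
    have e := hmem.1 (hLie _ hhf g hg) q v hv
    rw [P.bracket_mul_left, diff_coe_add, diff_coe_mul, diff_coe_mul,
      hmem.1 (hLie _ hf' g hg) q v hv, hmem.1 hf' q v hv, P.bracket_mul_left] at e
    simpa [h1.self_of_nhds, mem_vanishingIdeal.1 hf q, hh] using e

end Submanifold

section Linear

/-! ## Factoring a smooth family of functionals through a family of constant rank -/

/-- If `b q` vanishes on the kernel of `A q`, which has constant dimension, then locally
`b q = c q ∘ A q` for a smooth family `c`. -/
theorem exists_contMDiffOn_comp_eq {H : Type*} [NormedAddCommGroup H] [NormedSpace ℝ H]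
    {N : Type*} [TopologicalSpace N] [ChartedSpace H N]
    {R F : Type*} [NormedAddCommGroup R] [NormedSpace ℝ R] [FiniteDimensional ℝ R]
    [NormedAddCommGroup F] [NormedSpace ℝ F] [FiniteDimensional ℝ F]
    {A : N → R →L[ℝ] F} {b : N → R →L[ℝ] ℝ} {U : Set N} {s : ℕ} (hU : IsOpen U)
    (hA : ContMDiffOn 𝓘(ℝ, H) 𝓘(ℝ, R →L[ℝ] F) ∞ A U)
    (hb : ContMDiffOn 𝓘(ℝ, H) 𝓘(ℝ, R →L[ℝ] ℝ) ∞ b U)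
    (hrank : ∀ q ∈ U, Module.finrank ℝ (LinearMap.ker (A q).toLinearMap) = s)
    (hker : ∀ q ∈ U, ∀ a, A q a = 0 → b q a = 0) {p : N} (hp : p ∈ U) :
    ∃ U' : Set N, IsOpen U' ∧ p ∈ U' ∧ U' ⊆ U ∧ ∃ c : N → F →L[ℝ] ℝ,
      ContMDiffOn 𝓘(ℝ, H) 𝓘(ℝ, F →L[ℝ] ℝ) ∞ c U' ∧ ∀ q ∈ U', ∀ a, c q (A q a) = b q a := by
  -- On a complement `W` of `ker (A p)` the map `A p` has a left inverse `L`. Then `G q = L ∘ A q`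
  -- restricted to `W` is the identity at `p`, hence invertible nearby, and `b q ∘ (G q)⁻¹ ∘ L` is
  -- the required factor.
  obtain ⟨W, hW⟩ := Submodule.exists_isCompl (LinearMap.ker (A p).toLinearMap)
  have hinj : LinearMap.ker ((A p).toLinearMap ∘ₗ W.subtype) = ⊥ := by
    rw [LinearMap.ker_eq_bot']
    intro w hw
    exact Subtype.ext ((Submodule.disjoint_def.1 hW.disjoint) w hw w.2)
  obtain ⟨L', hL'⟩ := LinearMap.exists_leftInverse_of_injective _ hinj
  let L : F →L[ℝ] W := LinearMap.toContinuousLinearMap L'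
  let G : N → W →L[ℝ] W := fun q => L ∘L (A q ∘L W.subtypeL)
  have hG : ContMDiffOn 𝓘(ℝ, H) 𝓘(ℝ, W →L[ℝ] W) ∞ G U :=
    contMDiffOn_const.clm_comp (hA.clm_comp contMDiffOn_const)
  have hGp : G p = 1 := by
    ext1 w
    exact LinearMap.congr_fun hL' w
  let U' : Set N := U ∩ G ⁻¹' {g | IsUnit g}
  have hU' : IsOpen U' := hG.continuousOn.isOpen_inter_preimage hU Units.isOpen
  refine ⟨U', hU', ⟨hp, by simp [hGp]⟩, Set.inter_subset_left,
    fun q => (b q ∘L W.subtypeL) ∘L (Ring.inverse (G q) ∘L L), ?_, ?_⟩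
  · have hinv : ContMDiffOn 𝓘(ℝ, H) 𝓘(ℝ, W →L[ℝ] W) ∞ (fun q => Ring.inverse (G q)) U' := by
      intro q hq
      obtain ⟨u, hu⟩ := hq.2
      have h1 : ContDiffAt ℝ ∞ Ring.inverse (G q) := by
        rw [← hu]
        exact contDiffAt_ringInverse ℝ u
      exact h1.contMDiffAt.comp_contMDiffWithinAt q ((hG q hq.1).mono Set.inter_subset_left)
    exact ((hb.mono Set.inter_subset_left).clm_comp contMDiffOn_const).clm_comp
      (hinv.clm_comp contMDiffOn_const)
  · rintro q ⟨hq, hu⟩ a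
    have hinvG : ∀ w, Ring.inverse (G q) (G q w) = w := fun w => by
      have := Ring.inverse_mul_cancel (G q) hu
      exact congrArg (fun g : W →L[ℝ] W => g w) this
    have hdis : Disjoint W (LinearMap.ker (A q).toLinearMap) := by
      rw [Submodule.disjoint_def]
      intro w hw hk
      have h0 : G q ⟨w, hw⟩ = 0 := by
        change L (A q w) = 0
        rw [show A q w = 0 from hk, map_zero]
      have := hinvG ⟨w, hw⟩
      rw [h0, map_zero] at this
      exact congrArg Subtype.val this.symm
    -- Constant kernel dimension keeps `W` complementary to `ker (A q)`. Both sides vanish on the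
    -- kernel, so the identity need only be checked on `W`.
    have htop := Submodule.eq_top_of_disjoint _ _ (by
      rw [hrank q hq, ← hrank p hp, add_comm, Submodule.finrank_add_eq_of_isCompl hW]) hdis
    obtain ⟨w, hw, k, hk, rfl⟩ := Submodule.mem_sup.1 (htop ▸ Submodule.mem_top : a ∈ W ⊔ _)
    have hk' : A q k = 0 := hk
    have e1 : A q (w + k) = A q w := by rw [map_add, hk', add_zero]
    have e2 : b q (w + k) = b q w := by rw [map_add, hker q hq k hk', add_zero]
    rw [e1, e2]
    change b q (Ring.inverse (G q) (G q ⟨w, hw⟩)) = b q w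
    rw [hinvG]

end Linear

/-! ### Derivatives along sections of `T_N M`, and adapted coordinates -/

section Submanifold

variable {E : Type*} [NormedAddCommGroup E] [NormedSpace ℝ E]
  {M : Type*} [TopologicalSpace M] [ChartedSpace E M] [IsManifold 𝓘(ℝ, E) ∞ M]
  {E' : Type*} [NormedAddCommGroup E'] [NormedSpace ℝ E']
  {N : Type*} [TopologicalSpace N] [ChartedSpace E' N]
  {ι : N → M}

/-- The derivative of a smooth map along a smooth section of `T_N M` is smooth. -/
lemma IsSmoothSectionOn.contMDiffOn_mfderiv {G : Type*} [NormedAddCommGroup G] [NormedSpace ℝ G]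
    {u : M → G} {V : Set M} (hV : IsOpen V) (hu : ContMDiffOn 𝓘(ℝ, E) 𝓘(ℝ, G) ∞ u V)
    {s : ∀ q : N, TangentSpace 𝓘(ℝ, E) (ι q)} {U : Set N} (hs : IsSmoothSectionOn E' ι s U) :
    ContMDiffOn 𝓘(ℝ, E') 𝓘(ℝ, G) ∞
      (fun q => (mfderiv 𝓘(ℝ, E) 𝓘(ℝ, G) u (ι q) (s q) : G)) (U ∩ ι ⁻¹' V) := by
  have : IsManifold 𝓘(ℝ, E) 1 M := .of_le (n := ∞) (by simp)
  -- The derivative along the section is the fibre component of the tangent map of `u` composed with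
  -- it.
  have h1 := hu.contMDiffOn_tangentMapWithin (m := ∞) (by simp) hV.uniqueMDiffOn
  have h2 := (contMDiff_snd_tangentBundle_modelSpace G 𝓘(ℝ, G) (n := ∞)).comp_contMDiffOn
    (h1.comp (hs.mono (Set.inter_subset_left (t := ι ⁻¹' V))) fun q hq => hq.2)
  refine h2.congr fun q hq => ?_
  have e := mfderivWithin_of_isOpen (I := 𝓘(ℝ, E)) (I' := 𝓘(ℝ, G)) (f := u) hV hq.2
  exact congrArg (fun L : E →L[ℝ] G => L (s q)) e.symm

omit [IsManifold 𝓘(ℝ, E) ∞ M] in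
/-- Adapted coordinates of a submanifold: a local retraction `ρ` onto it, and a local smooth map
`y` which vanishes on it and whose differential vanishes on no other vectors than those tangent
to it. -/
theorem exists_adapted [IsManifold 𝓘(ℝ, E') ∞ N]
    (hι : Manifold.IsSmoothEmbedding 𝓘(ℝ, E') 𝓘(ℝ, E) ∞ ι) (p : N) :
    ∃ (V : Set M) (ρ : M → N) (y : M → E), IsOpen V ∧ ι p ∈ V ∧
      ContMDiffOn 𝓘(ℝ, E) 𝓘(ℝ, E') ∞ ρ V ∧ ContMDiffOn 𝓘(ℝ, E) 𝓘(ℝ, E) ∞ y V ∧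
      ∀ q, ι q ∈ V → ρ (ι q) = q ∧ y (ι q) = 0 ∧
        ∀ v : TangentSpace 𝓘(ℝ, E) (ι q), mfderiv 𝓘(ℝ, E) 𝓘(ℝ, E) y (ι q) v = 0 →
          v ∈ LinearMap.range (mfderiv 𝓘(ℝ, E') 𝓘(ℝ, E) ι q).toLinearMap := by
  have h := hι.isImmersion.isImmersionAt p
  let φ := h.domChart
  let ψ := h.codChart
  let e := h.equiv
  have hw : ∀ q ∈ φ.source, ψ (ι q) = e (φ q, 0) := by
    intro q hq
    have := h.writtenInCharts
      (show φ q ∈ (φ.extend 𝓘(ℝ, E')).target by simpa using φ.map_source hq)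
    have e0 : h.domChart.symm (φ q) = q := φ.left_inv hq
    simpa [e0] using this
  have hsrc : ∀ q ∈ φ.source, ι q ∈ ψ.source := h.source_subset_preimage_source
  have hψ := contMDiffOn_of_mem_maximalAtlas h.codChart_mem_maximalAtlas
  have hφ := contMDiffOn_symm_of_mem_maximalAtlas h.domChart_mem_maximalAtlas
  obtain ⟨V₁, hV₁, hV₁φ⟩ := hι.isEmbedding.isOpen_iff.1 φ.open_source
  let u : M → E' := fun z => (e.symm (ψ z)).1
  have hu : ContMDiffOn 𝓘(ℝ, E) 𝓘(ℝ, E') ∞ u ψ.source :=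
    ((ContinuousLinearMap.fst ℝ E' h.complement) ∘L
      (e.symm : E →L[ℝ] E' × h.complement)).contMDiff.comp_contMDiffOn hψ
  -- Intersecting with `V₁` ensures that only points of `N` in `φ.source` are mapped into `V`.
  let V : Set M := (ψ.source ∩ u ⁻¹' φ.target) ∩ V₁
  have hV : IsOpen V :=
    (hu.continuousOn.isOpen_inter_preimage ψ.open_source φ.open_target).inter hV₁
  -- In the charts `ι` reads `x ↦ e (x, 0)`, that is `j`. So `φ.symm ∘ u` is a retraction and `ψ - j
  -- ∘ u` is the transverse part of the chart.
  let j : E' →L[ℝ] E := (e : E' × h.complement →L[ℝ] E) ∘L ContinuousLinearMap.inl ℝ E' _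
  have hρ : ContMDiffOn 𝓘(ℝ, E) 𝓘(ℝ, E') ∞ (φ.symm ∘ u) V :=
    hφ.comp (hu.mono fun z hz => hz.1.1) fun z hz => hz.1.2
  have hy : ContMDiffOn 𝓘(ℝ, E) 𝓘(ℝ, E) ∞ (fun z => ψ z - j (u z)) V :=
    (hψ.mono fun z hz => hz.1.1).sub
      (j.contMDiff.comp_contMDiffOn (hu.mono fun z hz => hz.1.1))
  have huι : ∀ q, ι q ∈ V → q ∈ φ.source ∧ u (ι q) = φ q := fun q hq => by
    have hq' : q ∈ φ.source := by
      rw [← hV₁φ]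
      exact hq.2
    exact ⟨hq', by simp [u, hw q hq']⟩
  refine ⟨V, φ.symm ∘ u, fun z => ψ z - j (u z), hV, ?_, hρ, hy, fun q hq => ?_⟩
  · have hp : p ∈ φ.source := h.mem_domChart_source
    refine ⟨⟨hsrc p hp, ?_⟩, ?_⟩
    · simpa [u, hw p hp] using φ.map_source hp
    · rw [← Set.mem_preimage, hV₁φ]
      exact hp
  · obtain ⟨hqφ, huq⟩ := huι q hq
    have hρq : (φ.symm ∘ u) (ι q) = q := by simp [huq, φ.left_inv hqφ]
    refine ⟨hρq, ?_, fun v hv => ?_⟩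
    · change ψ (ι q) - e (u (ι q), 0) = 0
      rw [huq, hw q hqφ, sub_self]
    · have hVq := hV.mem_nhds hq
      have dψ : MDifferentiableAt 𝓘(ℝ, E) 𝓘(ℝ, E) ψ (ι q) :=
        (hψ.contMDiffAt (ψ.open_source.mem_nhds hq.1.1)).mdifferentiableAt (by simp)
      have dρ : MDifferentiableAt 𝓘(ℝ, E) 𝓘(ℝ, E') (φ.symm ∘ u) (ι q) :=
        (hρ.contMDiffAt hVq).mdifferentiableAt (by simp)
      have du : MDifferentiableAt 𝓘(ℝ, E) 𝓘(ℝ, E') u (ι q) :=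
        (hu.contMDiffAt (ψ.open_source.mem_nhds hq.1.1)).mdifferentiableAt (by simp)
      have dι : MDifferentiableAt 𝓘(ℝ, E') 𝓘(ℝ, E) ι q :=
        hι.contMDiff.contMDiffAt.mdifferentiableAt (by simp)
      have hjD : HasMFDerivAt 𝓘(ℝ, E) 𝓘(ℝ, E) (j ∘ u) (ι q)
          (j ∘L (mfderiv 𝓘(ℝ, E) 𝓘(ℝ, E') u (ι q) : E →L[ℝ] E')) :=
        j.hasMFDerivAt.comp (ι q) du.hasMFDerivAt
      have hyD := (dψ.hasMFDerivAt.sub hjD).mfderiv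
      have hv' : (mfderiv 𝓘(ℝ, E) 𝓘(ℝ, E) ψ (ι q) : E →L[ℝ] E) v =
          j ((mfderiv 𝓘(ℝ, E) 𝓘(ℝ, E') u (ι q) : E →L[ℝ] E') v) := by
        have e1 := congrArg (fun L : E →L[ℝ] E => L v) hyD
        exact sub_eq_zero.1 (e1.symm.trans hv)
      have dι' : HasMFDerivAt 𝓘(ℝ, E') 𝓘(ℝ, E) ι ((φ.symm ∘ u) (ι q))
          (mfderiv 𝓘(ℝ, E') 𝓘(ℝ, E) ι q : E' →L[ℝ] E) := by
        rw [hρq]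
        exact dι.hasMFDerivAt
      have dψ' : HasMFDerivAt 𝓘(ℝ, E) 𝓘(ℝ, E) ψ ((ι ∘ (φ.symm ∘ u)) (ι q))
          (mfderiv 𝓘(ℝ, E) 𝓘(ℝ, E) ψ (ι q) : E →L[ℝ] E) := by
        rw [Function.comp_apply, hρq]
        exact dψ.hasMFDerivAt
      have hcomp := dψ'.comp (ι q) (dι'.comp (ι q) dρ.hasMFDerivAt)
      -- Differentiating this identity gives `dψ (dι (dρ v)) = j (du v)`, with `ρ = φ.symm ∘ u`. If
      -- `dy v = 0`, the right side is `dψ v`, and injectivity of `dψ` yields `v = dι (dρ v)`.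
      have heq : ψ ∘ (ι ∘ (φ.symm ∘ u)) =ᶠ[𝓝 (ι q)] j ∘ u := by
        filter_upwards [hVq] with z hz
        have hz' : φ.symm (u z) ∈ φ.source := φ.map_target hz.1.2
        change ψ (ι (φ.symm (u z))) = e (u z, 0)
        rw [hw _ hz', φ.right_inv hz.1.2]
      have hD := hasMFDerivAt_unique hcomp (hjD.congr_of_eventuallyEq heq)
      have hmd : ψ.MDifferentiable 𝓘(ℝ, E) 𝓘(ℝ, E) :=
        ⟨hψ.mdifferentiableOn (by simp),
          (contMDiffOn_symm_of_mem_maximalAtlas h.codChart_mem_maximalAtlas).mdifferentiableOn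
            (by simp)⟩
      refine ⟨(mfderiv 𝓘(ℝ, E) 𝓘(ℝ, E') (φ.symm ∘ u) (ι q) : E →L[ℝ] E') v,
        hmd.mfderiv_injective hq.1.1 ?_⟩
      exact (congrArg (fun L : E →L[ℝ] E => L v) hD).trans hv'.symm

end Submanifold

/-- The linear map `ℝʳ → G` with given values on the standard basis. -/
noncomputable def frameMap {G : Type*} [NormedAddCommGroup G] [NormedSpace ℝ G] {r : ℕ}
    (g : Fin r → G) : (Fin r → ℝ) →L[ℝ] G :=
  ∑ i, (ContinuousLinearMap.proj i : (Fin r → ℝ) →L[ℝ] ℝ).smulRight (g i)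

lemma frameMap_apply {G : Type*} [NormedAddCommGroup G] [NormedSpace ℝ G] {r : ℕ}
    (g : Fin r → G) (a : Fin r → ℝ) : frameMap g a = ∑ i, a i • g i := by
  simp [frameMap]

lemma frameMap_comp {G G' : Type*} [NormedAddCommGroup G] [NormedSpace ℝ G]
    [NormedAddCommGroup G'] [NormedSpace ℝ G'] {r : ℕ} (L : G →L[ℝ] G')
    (g : Fin r → G) (a : Fin r → ℝ) : frameMap (fun i => L (g i)) a = L (frameMap g a) := by
  simp [frameMap_apply]

lemma contMDiffOn_frameMap {H : Type*} [NormedAddCommGroup H] [NormedSpace ℝ H]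
    {N : Type*} [TopologicalSpace N] [ChartedSpace H N]
    {G : Type*} [NormedAddCommGroup G] [NormedSpace ℝ G] {r : ℕ} {g : Fin r → N → G} {U : Set N}
    (hg : ∀ i, ContMDiffOn 𝓘(ℝ, H) 𝓘(ℝ, G) ∞ (g i) U) :
    ContMDiffOn 𝓘(ℝ, H) 𝓘(ℝ, (Fin r → ℝ) →L[ℝ] G) ∞ (fun q => frameMap fun i => g i q) U := by
  refine contMDiffOn_finsetSum fun i _ => ?_
  exact (ContinuousLinearMap.smulRightL ℝ (Fin r → ℝ) G
    (ContinuousLinearMap.proj i)).contMDiff.comp_contMDiffOn (hg i)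

section Submanifold

variable {E : Type*} [NormedAddCommGroup E] [NormedSpace ℝ E]
  {M : Type*} [TopologicalSpace M] [ChartedSpace E M] [IsManifold 𝓘(ℝ, E) ∞ M]
  {E' : Type*} [NormedAddCommGroup E'] [NormedSpace ℝ E']
  {N : Type*} [TopologicalSpace N] [ChartedSpace E' N]
  {ι : N → M} {B : ∀ q : N, Submodule ℝ (TangentSpace 𝓘(ℝ, E) (ι q))} {r s : ℕ}

/-! ## Extending first integrals -/

omit [IsManifold 𝓘(ℝ, E) ∞ M] in
lemma hasMFDerivAt_clm_apply {F G : Type*} [NormedAddCommGroup F] [NormedSpace ℝ F]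
    [NormedAddCommGroup G] [NormedSpace ℝ G] {c : M → F →L[ℝ] G} {y : M → F} {x : M}
    {c' : E →L[ℝ] F →L[ℝ] G} {y' : E →L[ℝ] F}
    (hc : HasMFDerivAt 𝓘(ℝ, E) 𝓘(ℝ, F →L[ℝ] G) c x c')
    (hy : HasMFDerivAt 𝓘(ℝ, E) 𝓘(ℝ, F) y x y') :
    HasMFDerivAt 𝓘(ℝ, E) 𝓘(ℝ, G) (fun z => c z (y z)) x (c x ∘L y' + c'.flip (y x)) := by
  refine ⟨hc.1.clm_apply hy.1, ?_⟩
  have h := hc.2.clm_apply hy.2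
  simp only [writtenInExtChartAt, extChartAt_model_space_eq_id, Function.comp_apply,
    extChartAt_to_inv] at h
  exact h

omit [IsManifold 𝓘(ℝ, E) ∞ M] in
lemma hasMFDerivAt_finset_sum {G : Type*} [NormedAddCommGroup G] [NormedSpace ℝ G]
    {α : Type*} {t : Finset α} {g : α → M → G} {g' : α → E →L[ℝ] G} {x : M}
    (hg : ∀ i ∈ t, HasMFDerivAt 𝓘(ℝ, E) 𝓘(ℝ, G) (g i) x (g' i)) :
    HasMFDerivAt 𝓘(ℝ, E) 𝓘(ℝ, G) (∑ i ∈ t, g i) x (∑ i ∈ t, g' i : E →L[ℝ] G) := by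
  classical
  induction t using Finset.induction_on with
  | empty => simpa using! hasMFDerivAt_const (0 : G) x
  | insert i t hi ih =>
    rw [Finset.sum_insert hi, Finset.sum_insert hi]
    exact (hg i (Finset.mem_insert_self i t)).add
      (ih fun j hj => hg j (Finset.mem_insert_of_mem hj))

/-- With adapted coordinates `ρ, y`, the extension `h ∘ ρ` has the right values. On vectors of `B`
its differential vanishes wherever `dy` does, that is on `B ∩ TN`, hence factors there as `c ∘ dy`
with `c` smooth by constant rank. Subtracting `c(ρ) y` corrects the derivative without changing the
values on `N`. -/
theorem exists_local_extension [IsManifold 𝓘(ℝ, E') ∞ N] [FiniteDimensional ℝ E]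
    (hι : Manifold.IsSmoothEmbedding 𝓘(ℝ, E') 𝓘(ℝ, E) ∞ ι)
    (hB : IsSubbundle E' ι r B) (hD : IsSubbundle E' ι s (interTangent E' ι B))
    (h : C^∞⟮𝓘(ℝ, E'), N; ℝ⟯)
    (hh : ∀ (q : N) (w : TangentSpace 𝓘(ℝ, E') q),
      mfderiv 𝓘(ℝ, E') 𝓘(ℝ, E) ι q w ∈ interTangent E' ι B q → diff (E := E') h q w = 0)
    (p : N) :
    ∃ (V : Set M) (f : M → ℝ), IsOpen V ∧ ι p ∈ V ∧ ContMDiffOn 𝓘(ℝ, E) 𝓘(ℝ) ∞ f V ∧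
      ∀ q, ι q ∈ V → f (ι q) = h q ∧ ∀ v ∈ B q, diff (E := E) f (ι q) v = 0 := by
  obtain ⟨V, ρ, y, hV, hpV, hρ, hy, hV'⟩ := exists_adapted hι p
  obtain ⟨U, hU, hpU, t, ht, ht'⟩ := hB p
  have hιs := hι.contMDiff
  let U₁ := U ∩ ι ⁻¹' V
  have hU₁ : IsOpen U₁ := hU.inter (hV.preimage hιs.continuous)
  have hhρ : ContMDiffOn 𝓘(ℝ, E) 𝓘(ℝ) ∞ (h ∘ ρ) V := h.contMDiff.comp_contMDiffOn hρ
  let dy : N → E →L[ℝ] E := fun q => mfderiv 𝓘(ℝ, E) 𝓘(ℝ, E) y (ι q)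
  let dh : N → E →L[ℝ] ℝ := fun q => diff (E := E) (h ∘ ρ) (ι q)
  let t' : N → Fin r → E := fun q i => t i q
  have hdyι : ∀ q, ι q ∈ V → ∀ w, dy q (mfderiv 𝓘(ℝ, E') 𝓘(ℝ, E) ι q w) = 0 := by
    intro q hq w
    have h1 := (((hy.contMDiffAt (hV.mem_nhds hq)).mdifferentiableAt
      (by simp)).hasMFDerivAt).comp q
        (hιs.contMDiffAt.mdifferentiableAt (x := q) (by simp)).hasMFDerivAt
    have h2 : y ∘ ι =ᶠ[𝓝 q] fun _ => 0 := by
      filter_upwards [(hV.preimage hιs.continuous).mem_nhds hq] with z hz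
      exact (hV' z hz).2.1
    have h3 := hasMFDerivAt_unique h1
      ((hasMFDerivAt_const (0 : E) q).congr_of_eventuallyEq h2)
    exact congrArg (fun L : E' →L[ℝ] E => L w) h3
  have hdhι : ∀ q, ι q ∈ V → ∀ w,
      dh q (mfderiv 𝓘(ℝ, E') 𝓘(ℝ, E) ι q w) = diff (E := E') h q w := by
    intro q hq w
    have h1 := (((hhρ.contMDiffAt (hV.mem_nhds hq)).mdifferentiableAt
      (by simp)).hasMFDerivAt).comp q
        (hιs.contMDiffAt.mdifferentiableAt (x := q) (by simp)).hasMFDerivAt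
    have h2 : (h ∘ ρ) ∘ ι =ᶠ[𝓝 q] h := by
      filter_upwards [(hV.preimage hιs.continuous).mem_nhds hq] with z hz
      exact congrArg h (hV' z hz).1
    have h3 := h1.mfderiv
    rw [h2.mfderiv_eq] at h3
    exact (congrArg (fun L : E' →L[ℝ] ℝ => L w) h3).symm
  have hdh0 : ∀ q, ι q ∈ V → ∀ v ∈ B q, dy q v = 0 → dh q v = 0 := by
    intro q hq v hv hv0
    obtain ⟨w, rfl⟩ := (hV' q hq).2.2 v hv0
    exact (hdhι q hq w).trans (hh q w ⟨hv, w, rfl⟩)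
  have hinter : ∀ q, ι q ∈ V → ∀ v, v ∈ interTangent E' ι B q ↔ v ∈ B q ∧ dy q v = 0 := by
    intro q hq v
    refine ⟨?_, fun hv => ⟨hv.1, (hV' q hq).2.2 v hv.2⟩⟩
    rintro ⟨hv, w, rfl⟩
    exact ⟨hv, hdyι q hq w⟩
  have hframe : ∀ q ∈ U, ∀ v, v ∈ B q ↔ ∃ a, frameMap (t' q) a = v := by
    intro q hq v
    rw [← (ht' q hq).2, Submodule.mem_span_range_iff_exists_fun]
    refine exists_congr fun a => ?_
    rw [frameMap_apply]
    rfl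
  obtain ⟨U', hU', hpU', hU'U, c, hc, hc'⟩ := exists_contMDiffOn_comp_eq (s := s) hU₁
    (A := fun q => frameMap fun i => dy q (t' q i)) (b := fun q => frameMap fun i => dh q (t' q i))
    (contMDiffOn_frameMap fun i => (ht i).contMDiffOn_mfderiv hV hy)
    (contMDiffOn_frameMap fun i => (ht i).contMDiffOn_mfderiv hV hhρ)
    -- The frame of `B` carries the kernel of `dy ∘ frame` isomorphically onto `B ∩ TN`, which has
    -- rank `s`.
    (fun q hq => by
      have hinj : Function.Injective (frameMap (t' q)).toLinearMap := by
        rw [← LinearMap.ker_eq_bot, LinearMap.ker_eq_bot']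
        intro a ha
        have ha' : ∑ i, a i • t' q i = 0 := by rw [← frameMap_apply]; exact ha
        exact funext (Fintype.linearIndependent_iff.1 (ht' q hq.1).1 a ha')
      have hmap : (LinearMap.ker (frameMap fun i => dy q (t' q i)).toLinearMap).map
          (frameMap (t' q)).toLinearMap = interTangent E' ι B q := by
        ext v
        constructor
        · rintro ⟨a, ha, rfl⟩
          exact (hinter q hq.2 _).2 ⟨(hframe q hq.1 _).2 ⟨a, rfl⟩,
            (frameMap_comp (dy q) (t' q) a).symm.trans ha⟩
        · intro hv
          obtain ⟨hv1, hv2⟩ := (hinter q hq.2 _).1 hv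
          obtain ⟨a, rfl⟩ := (hframe q hq.1 v).1 hv1
          exact ⟨a, (frameMap_comp (dy q) (t' q) a).trans hv2, rfl⟩
      rw [← hD.finrank_eq q, ← hmap]
      exact (Submodule.equivMapOfInjective _ hinj _).finrank_eq)
    (fun q hq a ha => by
      rw [frameMap_comp] at ha ⊢
      exact hdh0 q hq.2 _ ((hframe q hq.1 _).2 ⟨a, rfl⟩) ha)
    ⟨hpU, hpV⟩
  have hV₁ : IsOpen (V ∩ ρ ⁻¹' U') := hρ.continuousOn.isOpen_inter_preimage hV hU'
  have hcρ : ContMDiffOn 𝓘(ℝ, E) 𝓘(ℝ, E →L[ℝ] ℝ) ∞ (c ∘ ρ) (V ∩ ρ ⁻¹' U') :=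
    hc.comp (hρ.mono Set.inter_subset_left) fun z hz => hz.2
  have hcy : ContMDiffOn 𝓘(ℝ, E) 𝓘(ℝ) ∞ (fun z => c (ρ z) (y z)) (V ∩ ρ ⁻¹' U') :=
    hcρ.clm_apply (hy.mono Set.inter_subset_left)
  refine ⟨V ∩ ρ ⁻¹' U', fun z => h (ρ z) - c (ρ z) (y z), hV₁, ⟨hpV, ?_⟩,
    (hhρ.mono Set.inter_subset_left).sub hcy, fun q hq => ?_⟩
  · rw [Set.mem_preimage, (hV' p hpV).1]
    exact hpU'
  · obtain ⟨hρq, hyq, -⟩ := hV' q hq.1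
    have hqU' : q ∈ U' := by
      rw [← hρq]
      exact hq.2
    refine ⟨?_, fun v hv => ?_⟩
    · simp [hρq, hyq]
    · obtain ⟨a, rfl⟩ := (hframe q (hU'U hqU').1 v).1 hv
      have hnhds := hV₁.mem_nhds hq
      have e1 := ((hhρ.contMDiffAt (hV.mem_nhds hq.1)).mdifferentiableAt (by simp)).hasMFDerivAt
      have e2 := ((hcρ.contMDiffAt hnhds).mdifferentiableAt (by simp)).hasMFDerivAt
      have e3 := ((hy.contMDiffAt (hV.mem_nhds hq.1)).mdifferentiableAt (by simp)).hasMFDerivAt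
      have e4 := (e1.sub (hasMFDerivAt_clm_apply e2 e3)).mfderiv
      refine (congrArg (fun L : E →L[ℝ] ℝ => L (frameMap (t' q) a)) e4).trans ?_
      -- The derivative of the coefficient enters only paired with `y (ι q) = 0`.
      let dc : E →L[ℝ] E →L[ℝ] ℝ := mfderiv 𝓘(ℝ, E) 𝓘(ℝ, E →L[ℝ] ℝ) (c ∘ ρ) (ι q)
      change dh q (frameMap (t' q) a) - (c (ρ (ι q)) (dy q (frameMap (t' q) a))
        + dc (frameMap (t' q) a) (y (ι q))) = 0
      rw [hρq, hyq, map_zero, add_zero, ← frameMap_comp (dh q), ← frameMap_comp (dy q),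
        hc' q hqU', sub_self]

omit [TopologicalSpace N] in
/-- Local functions with prescribed values on a closed submanifold and annihilated by `B` can be
patched together. -/
theorem exists_global_extension [FiniteDimensional ℝ E] [T2Space M] [SecondCountableTopology M]
    {h : N → ℝ}
    (hloc : ∀ x : M, ∃ (V : Set M) (f : M → ℝ), IsOpen V ∧ x ∈ V ∧
      ContMDiffOn 𝓘(ℝ, E) 𝓘(ℝ) ∞ f V ∧
      ∀ q, ι q ∈ V → f (ι q) = h q ∧ ∀ v ∈ B q, diff (E := E) f (ι q) v = 0) :
    ∃ F : C^∞⟮𝓘(ℝ, E), M; ℝ⟯,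
      ∀ q, F (ι q) = h q ∧ ∀ v ∈ B q, diff (E := E) F (ι q) v = 0 := by
  have : LocallyCompactSpace M := Manifold.locallyCompact_of_finiteDimensional 𝓘(ℝ, E)
  choose V f hV hxV hf hfV using hloc
  obtain ⟨χ, hχ⟩ := SmoothPartitionOfUnity.exists_isSubordinate 𝓘(ℝ, E) isClosed_univ V hV
    fun x _ => Set.mem_iUnion.2 ⟨x, hxV x⟩
  refine ⟨⟨_, hχ.contMDiff_finsum_smul hV hf⟩, fun q => ?_⟩
  -- Subtracting the constant `h q` makes every factor `f i - h q` vanish at `ι q`, so the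
  -- derivatives of the partition functions drop out.
  have hev : (fun z => ∑ᶠ i, χ i z • f i z) =ᶠ[𝓝 (ι q)]
      (∑ i ∈ χ.fintsupport (ι q), fun z => χ i z * (f i z - h q)) + fun _ => h q := by
    filter_upwards [χ.eventually_finsupport_subset (ι q)] with z hz
    have h1 := χ.sum_finsupport' z (Set.mem_univ z) hz
    have h2 : ∑ᶠ i, χ i z • f i z = ∑ i ∈ χ.fintsupport (ι q), χ i z • f i z := by
      refine finsum_eq_sum_of_support_subset _ fun i hi => hz ?_
      rw [SmoothPartitionOfUnity.mem_finsupport]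
      exact left_ne_zero_of_smul hi
    rw [h2]
    simp only [Pi.add_apply, Finset.sum_apply, mul_sub, Finset.sum_sub_distrib, ← Finset.sum_mul,
      h1, smul_eq_mul]
    ring
  have hq : ∀ i ∈ χ.fintsupport (ι q), ι q ∈ V i := fun i hi =>
    hχ i ((χ.mem_fintsupport_iff _ _).1 hi)
  refine ⟨?_, fun v hv => ?_⟩
  · refine hev.self_of_nhds.trans ?_
    rw [Pi.add_apply, Finset.sum_apply, Finset.sum_eq_zero, zero_add]
    intro i hi
    rw [(hfV i q (hq i hi)).1, sub_self, mul_zero]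
  · change diff (E := E) (fun z => ∑ᶠ i, χ i z • f i z) (ι q) v = 0
    have hD : ∀ i ∈ χ.fintsupport (ι q), HasMFDerivAt 𝓘(ℝ, E) 𝓘(ℝ)
        (fun z => χ i z * (f i z - h q)) (ι q)
        (χ i (ι q) • diff (E := E) (f i) (ι q) : E →L[ℝ] ℝ) := by
      intro i hi
      have e1 := ((χ i).contMDiff.mdifferentiableAt (x := ι q) (by simp)).hasMFDerivAt
      have e2 := (((hf i).contMDiffAt ((hV i).mem_nhds (hq i hi))).mdifferentiableAt
        (by simp)).hasMFDerivAt
      have e3 := e1.mul (e2.sub (hasMFDerivAt_const (h q) (ι q)))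
      refine e3.congr_mfderiv ?_
      ext w
      change χ i (ι q) * (diff (E := E) (f i) (ι q) w - 0)
        + (f i (ι q) - h q) * diff (E := E) (χ i) (ι q) w = χ i (ι q) * diff (E := E) (f i) (ι q) w
      rw [(hfV i q (hq i hi)).1]
      ring
    have hS := ((hasMFDerivAt_finset_sum hD).add (hasMFDerivAt_const (h q) (ι q))).mfderiv
    rw [diff_congr hev]
    refine (congrArg (fun L : E →L[ℝ] ℝ => L v) hS).trans ?_
    change (∑ i ∈ χ.fintsupport (ι q), (χ i (ι q) • diff (E := E) (f i) (ι q) : E →L[ℝ] ℝ)) v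
      + 0 = 0
    rw [sum_apply, add_zero]
    refine Finset.sum_eq_zero fun i hi => ?_
    change χ i (ι q) * diff (E := E) (f i) (ι q) v = 0
    rw [(hfV i q (hq i hi)).2 v hv, mul_zero]

end Submanifold

/-! ### Comparing two subbundles along a closed submanifold -/

section Submanifold

variable {E : Type*} [NormedAddCommGroup E] [NormedSpace ℝ E] [FiniteDimensional ℝ E]
  {M : Type*} [TopologicalSpace M] [T2Space M] [SecondCountableTopology M]
  [ChartedSpace E M] [IsManifold 𝓘(ℝ, E) ∞ M]
  {E' : Type*} [NormedAddCommGroup E'] [NormedSpace ℝ E'] [FiniteDimensional ℝ E']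
  {N : Type*} [TopologicalSpace N] [ChartedSpace E' N] [IsManifold 𝓘(ℝ, E') ∞ N]
  {ι : N → M} {B B' : ∀ q : N, Submodule ℝ (TangentSpace 𝓘(ℝ, E) (ι q))} {r r' s : ℕ}

/-- A function on a closed submanifold which is constant along `B ∩ TN` extends to a function
annihilated by `B`. -/
theorem exists_mem_annihilated_extension
    (hι : Manifold.IsSmoothEmbedding 𝓘(ℝ, E') 𝓘(ℝ, E) ∞ ι) (hcl : IsClosed (Set.range ι))
    (hB : IsSubbundle E' ι r B) (hD : IsSubbundle E' ι s (interTangent E' ι B))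
    (h : C^∞⟮𝓘(ℝ, E'), N; ℝ⟯)
    (hh : ∀ (q : N) (w : TangentSpace 𝓘(ℝ, E') q),
      mfderiv 𝓘(ℝ, E') 𝓘(ℝ, E) ι q w ∈ interTangent E' ι B q → diff (E := E') h q w = 0) :
    ∃ F ∈ annihilated E' ι B, ∀ q, F (ι q) = h q := by
  have : T2Space N := hι.isEmbedding.t2Space
  obtain ⟨F, hF⟩ := exists_global_extension (ι := ι) (B := B) (h := h) fun x => by
    by_cases hx : x ∈ Set.range ι
    · obtain ⟨p, rfl⟩ := hx
      exact exists_local_extension hι hB hD h hh p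
    -- Closedness of `N` gives points off it a neighbourhood on which the conditions are vacuous.
    · exact ⟨(Set.range ι)ᶜ, fun _ => 0, hcl.isOpen_compl, hx, contMDiffOn_const,
        fun q hq => absurd ⟨q, rfl⟩ hq⟩
  exact ⟨F, (mem_annihilated_iff hι.contMDiff hB).2 fun q => (hF q).2, fun q => (hF q).1⟩

omit [FiniteDimensional ℝ E] [SecondCountableTopology M] in
lemma diff_comp_eq_zero_of_mem_annihilated
    (hι : Manifold.IsSmoothEmbedding 𝓘(ℝ, E') 𝓘(ℝ, E) ∞ ι) (hB : IsSubbundle E' ι r B)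
    {f : C^∞⟮𝓘(ℝ, E), M; ℝ⟯} (hf : f ∈ annihilated E' ι B) {h : N → ℝ}
    (hfh : ∀ q, f (ι q) = h q) {q : N} {w : TangentSpace 𝓘(ℝ, E') q}
    (hw : mfderiv 𝓘(ℝ, E') 𝓘(ℝ, E) ι q w ∈ B q) : diff (E := E') h q w = 0 := by
  have : T2Space N := hι.isEmbedding.t2Space
  obtain rfl : (f ∘ ι) = h := funext hfh
  have h1 := mfderiv_comp q (f.contMDiff.mdifferentiable (by simp) (ι q))
    (hι.contMDiff.mdifferentiable (by simp) q)
  exact (congrArg (fun L : E' →L[ℝ] ℝ => L w) h1).trans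
    ((mem_annihilated_iff hι.contMDiff hB).1 hf q _ hw)

/-- The restriction to `N` of a function annihilated by `B` is constant along `B ∩ TN = B' ∩ TN`, so
it extends to one annihilated by `B'`; the two differ by an element of the vanishing ideal. -/
lemma sumSubalgebra_le_of_interTangent_eq
    (hι : Manifold.IsSmoothEmbedding 𝓘(ℝ, E') 𝓘(ℝ, E) ∞ ι) (hcl : IsClosed (Set.range ι))
    (hB : IsSubbundle E' ι r B) (hB' : IsSubbundle E' ι r' B')
    (hD : IsSubbundle E' ι s (interTangent E' ι B'))
    (heq : interTangent E' ι B = interTangent E' ι B') :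
    sumSubalgebra (annihilated E' ι B) (vanishingIdeal ι) ≤
      sumSubalgebra (annihilated E' ι B') (vanishingIdeal ι) := by
  rintro _ ⟨f, hf, i, hi, rfl⟩
  obtain ⟨F, hF, hFf⟩ := exists_mem_annihilated_extension hι hcl hB' hD
    ⟨f ∘ ι, f.contMDiff.comp hι.contMDiff⟩ fun q w hw =>
      diff_comp_eq_zero_of_mem_annihilated hι hB hf (fun _ => rfl) (by
        rw [← heq] at hw
        exact hw.1)
  refine ⟨F, hF, f - F + i, Ideal.add_mem _ (fun q => ?_) hi, by ring⟩
  exact sub_eq_zero.2 (hFf q).symm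

/-- A first integral of `B' ∩ TN` extends to a function annihilated by `B'`, hence is also the
restriction of one annihilated by `B`. It is thus constant along `B ∩ TN`, and determinacy of `B' ∩
TN` applies. -/
lemma interTangent_le_of_sumSubalgebra_le
    (hι : Manifold.IsSmoothEmbedding 𝓘(ℝ, E') 𝓘(ℝ, E) ∞ ι) (hcl : IsClosed (Set.range ι))
    (hB : IsSubbundle E' ι r B) (hB' : IsSubbundle E' ι r' B')
    (hD : IsSubbundle E' ι s (interTangent E' ι B'))
    (hdet : DeterminedByFirstIntegrals E' ι (interTangent E' ι B'))
    (hle : sumSubalgebra (annihilated E' ι B') (vanishingIdeal ι) ≤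
      sumSubalgebra (annihilated E' ι B) (vanishingIdeal ι)) (q : N) :
    interTangent E' ι B q ≤ interTangent E' ι B' q := by
  rintro _ ⟨hw, w, rfl⟩
  refine hdet q w fun h hh => ?_
  obtain ⟨F, hF, hFh⟩ := exists_mem_annihilated_extension hι hcl hB' hD h hh
  obtain ⟨f, hf, i, hi, hfi⟩ := hle ⟨F, hF, 0, Ideal.zero_mem _, add_zero F⟩
  refine diff_comp_eq_zero_of_mem_annihilated hι hB hf (fun p => ?_) hw
  rw [← hFh p, ← hfi]
  change f (ι p) = f (ι p) + i (ι p)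
  rw [hi p, add_zero]

end Submanifold

end Reduction

/-! ### The reduction theorem -/

open Reduction in
theorem theorem1
    {E : Type*} [NormedAddCommGroup E] [NormedSpace ℝ E] [FiniteDimensional ℝ E]
    {M : Type*} [TopologicalSpace M] [T2Space M] [SecondCountableTopology M]
    [ChartedSpace E M] [IsManifold 𝓘(ℝ, E) ∞ M]
    {E' : Type*} [NormedAddCommGroup E'] [NormedSpace ℝ E'] [FiniteDimensional ℝ E']
    {N : Type*} [TopologicalSpace N] [ChartedSpace E' N] [IsManifold 𝓘(ℝ, E') ∞ N]
    -- the Poisson manifold `(M, P)` and the embedded submanifold `ι : N → M`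
    (P : BivectorField E M) (hP : P.IsPoisson)
    (ι : N → M) (hι : Manifold.IsSmoothEmbedding 𝓘(ℝ, E') 𝓘(ℝ, E) ∞ ι)
    -- the nonzero subbundle `B` of `T_N M`, whose annihilated functions form a Lie subalgebra
    (r : ℕ) (B : ∀ q : N, Submodule ℝ (TangentSpace 𝓘(ℝ, E) (ι q)))
    (hB : IsSubbundle E' ι r B) (hB0 : ∃ q, B q ≠ ⊥)
    (hLie : IsLieSubalgebra P.bracket (annihilated E' ι B)) :
    -- (a)
    (annihilated E' ι B : Set C^∞⟮𝓘(ℝ, E), M; ℝ⟯) ⊆ lieNormaliser P.bracket (vanishingIdeal ι) ∧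
    -- (b)
    IsPoissonIdeal hLie (interIdeal (annihilated E' ι B) (vanishingIdeal ι)) ∧
    -- (c)
    (∃! R : PoissonBracket
        (annihilated E' ι B ⧸ interIdeal (annihilated E' ι B) (vanishingIdeal ι)),
      IsInherited hLie (vanishingIdeal ι) R) ∧
    -- (d), first part: the bracket transported to `(𝓑 + 𝓘) / 𝓘` by the canonical isomorphism
    (∃! Q : PoissonBracket (sumQuotient (annihilated E' ι B) (vanishingIdeal ι)),
      IsInduced hLie (vanishingIdeal ι) Q) ∧
    (∃ e : (annihilated E' ι B ⧸ interIdeal (annihilated E' ι B) (vanishingIdeal ι)) ≃ₐ[ℝ]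
          sumQuotient (annihilated E' ι B) (vanishingIdeal ι),
      (∀ f, e (Ideal.Quotient.mk _ f) =
        toSumQuotient (annihilated E' ι B) (vanishingIdeal ι) f) ∧
      ∀ R Q, IsInherited hLie (vanishingIdeal ι) R → IsInduced hLie (vanishingIdeal ι) Q →
        ∀ a b, e (R.bracket a b) = Q.bracket (e a) (e b)) ∧
    -- (d), second part: comparison with another subbundle `B'`
    (∀ (r' : ℕ) (B' : ∀ q : N, Submodule ℝ (TangentSpace 𝓘(ℝ, E) (ι q))),
      IsSubbundle E' ι r' B' → (∃ q, B' q ≠ ⊥) →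
      ∀ hLie' : IsLieSubalgebra P.bracket (annihilated E' ι B'),
        -- the two induced brackets agree wherever both are defined
        (∀ Q Q', IsInduced hLie (vanishingIdeal ι) Q → IsInduced hLie' (vanishingIdeal ι) Q' →
          ∀ a b (ha : a ∈ sumQuotient (annihilated E' ι B) (vanishingIdeal ι))
            (hb : b ∈ sumQuotient (annihilated E' ι B) (vanishingIdeal ι))
            (ha' : a ∈ sumQuotient (annihilated E' ι B') (vanishingIdeal ι))
            (hb' : b ∈ sumQuotient (annihilated E' ι B') (vanishingIdeal ι)),
            (Q.bracket ⟨a, ha⟩ ⟨b, hb⟩ : C^∞⟮𝓘(ℝ, E), M; ℝ⟯ ⧸ vanishingIdeal (E := E) ι) =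
              Q'.bracket ⟨a, ha'⟩ ⟨b, hb'⟩) ∧
        -- if `B ∩ TN = B' ∩ TN`, they are defined on the same space
        (IsClosed (Set.range ι) → (∃ s, IsSubbundle E' ι s (interTangent E' ι B)) →
          interTangent E' ι B = interTangent E' ι B' →
          sumSubalgebra (annihilated E' ι B) (vanishingIdeal ι) =
            sumSubalgebra (annihilated E' ι B') (vanishingIdeal ι)) ∧
        -- the converse
        (IsClosed (Set.range ι) →
          (∃ s, IsSubbundle E' ι s (interTangent E' ι B)) →
          (∃ s, IsSubbundle E' ι s (interTangent E' ι B')) →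
          DeterminedByFirstIntegrals E' ι (interTangent E' ι B) →
          DeterminedByFirstIntegrals E' ι (interTangent E' ι B') →
          sumSubalgebra (annihilated E' ι B) (vanishingIdeal ι) =
            sumSubalgebra (annihilated E' ι B') (vanishingIdeal ι) →
          interTangent E' ι B = interTangent E' ι B')) := by
  have hbr := P.poissonBracket_apply hP
  have hn := annihilated_subset_lieNormaliser P hι hB hB0 hLie
  refine ⟨hn, isPoissonIdeal_interIdeal hLie hn,
    existsUnique_isInherited (P.poissonBracket hP) hbr hLie hn,
    existsUnique_isInduced (P.poissonBracket hP) hbr hLie hn,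
    exists_algEquiv_sumQuotient hLie, fun r' B' hB' hB0' hLie' => ⟨?_, ?_, ?_⟩⟩
  · intro Q Q' hQ hQ' a b ha hb ha' hb'
    exact hQ.bracket_eq (P.poissonBracket hP) hbr hn
      (annihilated_subset_lieNormaliser P hι hB' hB0' hLie') hQ' ha hb ha' hb'
  · rintro hcl ⟨s, hD⟩ heq
    -- Constant rank of `B' ∩ TN` is inherited from `B ∩ TN` through their equality.
    exact le_antisymm (sumSubalgebra_le_of_interTangent_eq hι hcl hB hB' (heq ▸ hD) heq)
      (sumSubalgebra_le_of_interTangent_eq hι hcl hB' hB hD heq.symm)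
  · rintro hcl ⟨s, hD⟩ ⟨s', hD'⟩ hdet hdet' heq
    exact funext fun q => le_antisymm
      (interTangent_le_of_sumSubalgebra_le hι hcl hB hB' hD' hdet' heq.ge q)
      (interTangent_le_of_sumSubalgebra_le hι hcl hB' hB hD hdet heq.le q)
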